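/- Let $\varphi$ be a fixed rational number with $0<\varphi<1$. For a finite set $\mathcal C$ of $m$ alternatives, let $\mathcal L(\mathcal C)$ be the set of linear orders over $\mathcal C$ (votes), let $\mathcal B(\mathcal C)\supseteq\mathcal L(\mathcal C)$ be the set of irreflexive, antisymmetric, total binary relations over $\mathcal C$, and for $V,W\in\mathcal B(\mathcal C)$ let $\mathrm{Kendall}(V,W)$ be the number of pairs of alternatives on which $V$ and $W$ disagree. In the framework $\mathcal F_\varphi^2$ the parameter space is $\mathcal B(\mathcal C)$; the likelihood of a profile $P$ (a finite list of votes) given $W\in\mathcal B(\mathcal C)$ is $\Pr(P\mid W)=\prod_{V\in P}\frac1Z\varphi^{\mathrm{Kendall}(V,W)}$, where $Z=\sum_{U\in\mathcal B(\mathcal C)}\varphi^{\mathrm{Kendall}(U,W)}$; the decisions are the non-empty subsets $d$ of $\mathcal C$; and the loss is $L_{top}(W,d)=\frac1{|d|}\sum_{c\in d}L_{top}(W,c)$, where $L_{top}(W,c)=0$ if $c$ is preferred to all other alternatives in $W$, and $L_{top}(W,c)=1$ otherwise. Let $R_B(P,d)$ be the expected loss of $d$ under the posterior distribution over $\mathcal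 B(\mathcal C)$ given $P$, for the uniform prior. Then the following two decision problems are in $\mathsf P$, where $\mathcal C$ and $P$ are part of the input, the profile being listed vote by vote: (1) (better Bayesian decision) given $\mathcal C$, non-empty subsets $d_1,d_2$ of $\mathcal C$ and a profile $P$, decide whether $R_B(P,d_1)\le R_B(P,d_2)$; (2) (optimal Bayesian decision) given $\mathcal C$, a non-empty subset $d$ of $\mathcal C$ and a profile $P$, decide whether $R_B(P,d)\le R_B(P,d')$ for all non-empty subsets $d'$ of $\mathcal C$. -/

import Mathlib

namespace BayesVoting

/-! ### Votes, profiles and tournaments over the alternatives `Fin m` -/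

/-- A vote, i.e. a linear order over the `m` alternatives, given as the ranking from top to
bottom: `V i` is the alternative in position `i`, position `0` being the top. -/
abbrev Vote (m : ℕ) : Type := Equiv.Perm (Fin m)

/-- A profile: the finite list of the votes of all agents. -/
abbrev Profile (m : ℕ) : Type := List (Vote m)

/-- The set of all irreflexive, antisymmetric and total binary relations over the alternatives;
`W.1 a b` reads: `a` is preferred to `b` in `W`. -/
def Tournament (m : ℕ) : Type :=
  {r : Fin m → Fin m → Prop //
    (∀ a, ¬ r a a) ∧ (∀ a b, r a b → r b a → a = b) ∧ (∀ a b, a ≠ b → r a b ∨ r b a)}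

noncomputable instance (m : ℕ) : Fintype (Tournament m) := by
  classical
  unfold Tournament
  infer_instance

/-- A linear order, seen as a binary relation: `a` is preferred to `b` if its position is
strictly closer to the top. -/
def Vote.toTournament {m : ℕ} (V : Vote m) : Tournament m :=
  ⟨fun a b => V.symm a < V.symm b,
    fun _ => lt_irrefl _,
    fun _ _ h h' => absurd h' (lt_asymm h),
    fun _ _ h => lt_or_gt_of_ne fun e => h (V.symm.injective e)⟩

open Classical in
/-- The Kendall-tau distance: the number of pairs of alternatives on which the two relations
disagree. Each unordered pair of distinct alternatives is counted once, as `(a, b)`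
with `a < b`. -/
noncomputable def kendall {m : ℕ} (V W : Tournament m) : ℕ :=
  (Finset.univ.filter fun p : Fin m × Fin m => p.1 < p.2 ∧ ¬ (V.1 p.1 p.2 ↔ W.1 p.1 p.2)).card

/-! ### Bayesian risk for a parametric ranking model with finite parameter space -/

/-- The likelihood of a profile whose votes are drawn independently from `pr θ`. -/
def likelihood {m : ℕ} {Θ : Type} (pr : Θ → Vote m → ℝ) (P : Profile m) (θ : Θ) : ℝ :=
  (P.map (pr θ)).prod

/-- The posterior probability of the parameter `θ` given the profile, by Bayes' rule. -/
noncomputable def posterior {m : ℕ} {Θ : Type} [Fintype Θ] (prior : Θ → ℝ)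
    (pr : Θ → Vote m → ℝ) (P : Profile m) (θ : Θ) : ℝ :=
  likelihood pr P θ * prior θ / ∑ θ', likelihood pr P θ' * prior θ'

/-- The Bayesian risk of a decision: its expected loss under the posterior distribution. -/
noncomputable def bayesRisk {m : ℕ} {Θ D : Type} [Fintype Θ] (prior : Θ → ℝ)
    (pr : Θ → Vote m → ℝ) (loss : Θ → D → ℝ) (P : Profile m) (d : D) : ℝ :=
  ∑ θ, posterior prior pr P θ * loss θ d

/-- The uniform prior. -/
noncomputable def uniformPrior (Θ : Type) [Fintype Θ] : Θ → ℝ :=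
  fun _ => 1 / (Fintype.card Θ : ℝ)

/-! ### The Condorcet model with top-loss -/

/-- The Condorcet model with dispersion `φ`: the parameters are all tournaments, and the vote `V`
has weight `φ ^ kendall V W / Z`, where `Z` is the sum of `φ ^ kendall U W` over all
tournaments `U`. -/
noncomputable def condorcetPr (φ : ℝ) {m : ℕ} (W : Tournament m) (V : Vote m) : ℝ :=
  1 / (∑ U : Tournament m, φ ^ kendall U W) * φ ^ kendall V.toTournament W

/-- The decision space: all non-empty sets of alternatives. -/
abbrev Decision (m : ℕ) : Type := {d : Finset (Fin m) // d.Nonempty}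

open Classical in
/-- The loss of a single alternative `c`: `0` if `c` is preferred to every other alternative,
and `1` otherwise. -/
noncomputable def topLoss {m : ℕ} (W : Tournament m) (c : Fin m) : ℝ :=
  if ∀ b, b ≠ c → W.1 c b then 0 else 1

/-- The loss of a set of alternatives: the average of the losses of its members. -/
noncomputable def topLossSet {m : ℕ} (W : Tournament m) (d : Decision m) : ℝ :=
  (∑ c ∈ d.1, topLoss W c) / (d.1.card : ℝ)

/-- The Bayesian risk in the framework made of the Condorcet model with dispersion `φ`, the
non-empty sets of alternatives as decisions and the top-loss, under the uniform prior. -/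
noncomputable def condorcetRisk (φ : ℝ) {m : ℕ} (P : Profile m) (d : Decision m) : ℝ :=
  bayesRisk (uniformPrior (Tournament m)) (condorcetPr φ) topLossSet P d

/-! ### Instances as strings, over Mathlib's Turing machine alphabet -/

open Computability (Γ')

/-- An alternative is written in unary, followed by a comma. As every vote lists all `m`
alternatives and every decision takes `m` bits, the lengths of the inputs are polynomially
related to those with binary names. -/
def encodeAlternative {m : ℕ} (a : Fin m) : List Γ' :=
  List.replicate (a : ℕ) (Γ'.bit true) ++ [Γ'.comma]

/-- A vote is written as the list of the alternatives from top to bottom. -/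
def encodeVote {m : ℕ} (V : Vote m) : List Γ' :=
  (List.ofFn V).flatMap encodeAlternative ++ [Γ'.ket]

/-- A profile is written vote by vote. -/
def encodeProfile {m : ℕ} (P : Profile m) : List Γ' :=
  P.flatMap encodeVote

/-- A set of alternatives is written as its `m` membership bits. -/
def encodeDecision {m : ℕ} (d : Decision m) : List Γ' :=
  List.ofFn (fun a : Fin m => Γ'.bit (decide (a ∈ d.1))) ++ [Γ'.ket]

/-! ### Decision problems and the class P -/

/-- The better-Bayesian-decision problem: given the alternatives, two decisions and a profile, is
the risk of the first decision at most that of the second? -/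
def BetterBayesianDecision (φ : ℝ) : Language Γ' :=
  {w | ∃ (m : ℕ) (d₁ d₂ : Decision m) (P : Profile m),
    w = encodeDecision d₁ ++ encodeDecision d₂ ++ encodeProfile P ∧
      condorcetRisk φ P d₁ ≤ condorcetRisk φ P d₂}

/-- The optimal-Bayesian-decision problem: given the alternatives, a decision and a profile, does
the decision minimize the risk among all decisions? -/
def OptimalBayesianDecision (φ : ℝ) : Language Γ' :=
  {w | ∃ (m : ℕ) (d : Decision m) (P : Profile m),
    w = encodeDecision d ++ encodeProfile P ∧
      ∀ d' : Decision m, condorcetRisk φ P d ≤ condorcetRisk φ P d'}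

open Classical in
/-- The class P: some Turing machine decides, for every string over the alphabet, whether it
belongs to the language, in time polynomial in the length of the string. -/
def InP {A : Type} (L : Language A) : Prop :=
  Nonempty (Turing.TM2ComputableInPolyTime (id : List A → List A) Computability.encodeBool
    fun w => decide (w ∈ L))

end BayesVoting

/-!
The posterior over the tournaments factorizes over the pairs of alternatives, so that summing over
all tournaments in which `c` is on top leaves a product of one factor per pair. For the dispersion
`p / q`, clearing denominators turns the posterior probability that `c` is on top into a natural
number `score p q P c`, a product over all ordered pairs of alternatives, up to a positive factor
that does not depend on `c` (`score_eq`). Hence the risk of a decision is a decreasing affine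
function of the average score of its members (`condorcetRisk_eq`): comparing two decisions amounts
to comparing two natural numbers (`condorcetRisk_le_iff`), and a decision is optimal exactly if all
its members have maximal score (`condorcetRisk_optimal_iff`). The scores have polynomially many
binary digits and are computed by polynomially many additions and multiplications.

To turn this into Turing machines, `Prog` is a small structured language over four stacks of bits
that compiles to the multi-stack machines of Mathlib with preservation of the running time
(`Exec.reach`). All data are coded as binary trees, written in preorder; this code is prefix-free,
so that values can be kept on a stack, and pairing costs a single bit. The predicate `PTime`
expresses that a function between coded types is computed by a program in polynomial time. It is
closed under composition, pairing, case analysis, and iteration as long as the intermediate values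
stay polynomially bounded (`PTime.iterate`), hence under folds (`PTime.foldl`), and the usual list
functions and binary arithmetic follow. A language whose characteristic function is in `PTime`
belongs to P (`inP_of_pTime`).

The decision procedures `betterDec` and `optimalDec` cut the input at the separators, without
regard to its syntax, and check the syntax by writing the data so obtained again and comparing with
the input.
-/

namespace BayesVoting

open Computability (Γ')
open Polynomial (X)
open Turing (TM2.Stmt TM2.Cfg)

/-! ### A structured language over four stacks of bits -/

/-- The four work stacks. Values are kept on `main`; the others are scratch space. -/
inductive Reg
  | main | a | b | c
  deriving DecidableEq

/-- The contents of the work stacks. -/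
structure Store where
  /-- The stack of values. -/
  main : List Bool
  /-- A scratch stack. -/
  a : List Bool
  /-- A scratch stack. -/
  b : List Bool
  /-- A scratch stack, which also holds counters and flags of loops. -/
  c : List Bool

/-- The contents of a given stack. -/
def Store.get (s : Store) : Reg → List Bool
  | .main => s.main
  | .a => s.a
  | .b => s.b
  | .c => s.c

/-- Replace the contents of a given stack. -/
def Store.set (s : Store) : Reg → List Bool → Store
  | .main, l => { s with main := l }
  | .a, l => { s with a := l }
  | .b, l => { s with b := l }
  | .c, l => { s with c := l }

/-- Programs. `p ;; q` runs `p` and then `q`. `pop r k` pops `r` and continues with `k o`, where `o`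
is what was popped (`none` if `r` was empty). `loop r k` pops `r` and runs `k` on the symbol popped,
until `r` is empty. -/
inductive Prog
  | skip : Prog
  | push (r : Reg) (x : Bool) : Prog
  | seq (p q : Prog) : Prog
  | pop (r : Reg) (k : Option Bool → Prog) : Prog
  | loop (r : Reg) (k : Bool → Prog) : Prog

infixr:60 " ;; " => Prog.seq

/-- `Exec p s s' t`: started on `s`, the program `p` ends on `s'` within time `t`.
The time is an upper bound; see `Exec.mono`. -/
inductive Exec : Prog → Store → Store → ℕ → Prop
  | skip (s) : Exec .skip s s 1
  | push (r x s) : Exec (.push r x) s (s.set r (x :: s.get r)) 1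
  | seq {p q s₁ s₂ s₃ t₁ t₂} : Exec p s₁ s₂ t₁ → Exec q s₂ s₃ t₂ → Exec (p ;; q) s₁ s₃ (t₁ + t₂)
  | pop {r k s s' t} : Exec (k (s.get r).head?) (s.set r (s.get r).tail) s' t →
      Exec (.pop r k) s s' (t + 1)
  | loop_nil {r k s} : s.get r = [] → Exec (.loop r k) s s 1
  | loop_cons {r k s x l s₁ s₂ t₁ t₂} : s.get r = x :: l → Exec (k x) (s.set r l) s₁ t₁ →
      Exec (.loop r k) s₁ s₂ t₂ → Exec (.loop r k) s s₂ (1 + t₁ + t₂)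
  | mono {p s s' t t'} : Exec p s s' t → t ≤ t' → Exec p s s' t'

/-! ### Compilation to a multi-stack Turing machine -/

/-- The stacks of the machine: input, output and the work stacks. -/
inductive Stk
  | inp | out | reg (r : Reg)
  deriving DecidableEq

instance : Fintype Stk :=
  ⟨{.inp, .out, .reg .main, .reg .a, .reg .b, .reg .c}, fun k => by
    rcases k with _ | _ | r
    · decide
    · decide
    · cases r <;> decide⟩

/-- The stack alphabets. -/
abbrev Sym : Stk → Type
  | .inp => Γ'
  | .out => Bool
  | .reg _ => Bool

/-- The labels used by the compiled program. -/
def Label : Prog → Type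
  | .skip => Unit
  | .push _ _ => Unit
  | .seq p q => Label p ⊕ Label q
  | .pop _ k => Option (Σ o, Label (k o))
  | .loop _ k => Option (Σ x, Label (k x))

/-- A program has finitely many labels. -/
@[reducible]
def Label.fintype : (p : Prog) → Fintype (Label p)
  | .skip => inferInstanceAs (Fintype Unit)
  | .push _ _ => inferInstanceAs (Fintype Unit)
  | .seq p q =>
    letI := Label.fintype p
    letI := Label.fintype q
    inferInstanceAs (Fintype (Label p ⊕ Label q))
  | .pop _ k =>
    letI := fun o => Label.fintype (k o)
    inferInstanceAs (Fintype (Option (Σ o, Label (k o))))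
  | .loop _ k =>
    letI := fun x => Label.fintype (k x)
    inferInstanceAs (Fintype (Option (Σ x, Label (k x))))

instance (p : Prog) : Fintype (Label p) := Label.fintype p

/-- The label at which the compiled program starts. -/
def Label.entry : (p : Prog) → Label p
  | .skip => ()
  | .push _ _ => ()
  | .seq p _ => Sum.inl (Label.entry p)
  | .pop _ _ => none
  | .loop _ _ => none

/-- The code at each label of `p`, when the labels of `p` are embedded by `emb` into those of a
larger machine and control is handed over to the label `e` at the end. The internal state of the
machine holds the symbol popped last. -/
def compile {Λ : Type} : (p : Prog) → (emb : Label p → Λ) → (e : Λ) → Label p →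
    TM2.Stmt Sym Λ (Option Bool)
  | .skip, _, e, _ => .goto fun _ => e
  | .push r x, _, e, _ => .push (.reg r) (fun _ => x) (.goto fun _ => e)
  | .seq p q, emb, _, .inl l =>
    compile p (fun l => emb (.inl l)) (emb (.inr (Label.entry q))) l
  | .seq _ q, emb, e, .inr l => compile q (fun l => emb (.inr l)) e l
  | .pop r k, emb, _, none =>
    .pop (.reg r) (fun _ o => o) (.goto fun v => emb (some ⟨v, Label.entry (k v)⟩))
  | .pop _ k, emb, e, some ⟨o, l⟩ => compile (k o) (fun l => emb (some ⟨o, l⟩)) e l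
  | .loop r k, emb, e, none =>
    .pop (.reg r) (fun _ o => o) (.goto fun v => match v with
      | none => e
      | some x => emb (some ⟨x, Label.entry (k x)⟩))
  | .loop _ k, emb, _, some ⟨x, l⟩ => compile (k x) (fun l => emb (some ⟨x, l⟩)) (emb none) l

/-- The contents of all stacks of the machine. -/
def stackContents (i : List Γ') (o : List Bool) (s : Store) : ∀ k, List (Sym k)
  | .inp => i
  | .out => o
  | .reg r => s.get r

theorem stackContents_set (i : List Γ') (o : List Bool) (s : Store) (r : Reg) (l : List Bool) :
    stackContents i o (s.set r l) = Function.update (stackContents i o s) (.reg r) l := by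
  funext k
  by_cases h : k = .reg r
  · subst h
    cases r <;> simp [stackContents, Store.set, Store.get]
  · rw [Function.update_of_ne h]
    rcases k with _ | _ | r'
    · rfl
    · rfl
    · cases r <;> cases r' <;> first | rfl | exact absurd rfl h

/-- `M` gets from one configuration to another within `n` steps. -/
def Reach {Λ : Type} (M : Λ → TM2.Stmt Sym Λ (Option Bool)) (n : ℕ)
    (x y : TM2.Cfg Sym Λ (Option Bool)) : Prop :=
  ∃ k ≤ n, (flip bind (Turing.TM2.step M))^[k] (some x) = some y

section Reach

variable {Λ : Type} {M : Λ → TM2.Stmt Sym Λ (Option Bool)} {n m : ℕ}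
  {x y z : TM2.Cfg Sym Λ (Option Bool)}

theorem Reach.mono (h : Reach M n x y) (hnm : n ≤ m) : Reach M m x y :=
  let ⟨k, hk, e⟩ := h
  ⟨k, hk.trans hnm, e⟩

theorem Reach.trans (h₁ : Reach M n x y) (h₂ : Reach M m y z) : Reach M (n + m) x z := by
  obtain ⟨k₁, hk₁, e₁⟩ := h₁
  obtain ⟨k₂, hk₂, e₂⟩ := h₂
  refine ⟨k₂ + k₁, by omega, ?_⟩
  rw [Function.iterate_add_apply, e₁, e₂]

theorem Reach.single (h : Turing.TM2.step M x = some y) : Reach M 1 x y :=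
  ⟨1, le_rfl, h⟩

end Reach

/-- Compilation is correct and preserves time bounds. -/
theorem Exec.reach {Λ : Type} {M : Λ → TM2.Stmt Sym Λ (Option Bool)} {i : List Γ'}
    {o : List Bool} {p : Prog} {s s' : Store} {t : ℕ} (h : Exec p s s' t) :
    ∀ (emb : Label p → Λ) (e : Λ), (∀ l, M (emb l) = compile p emb e l) → ∀ v, ∃ v',
      Reach M t ⟨some (emb (Label.entry p)), v, stackContents i o s⟩
        ⟨some e, v', stackContents i o s'⟩ := by
  induction h with
  | skip s =>
    intro emb e hM v
    refine ⟨v, Reach.single ?_⟩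
    simp only [Turing.TM2.step]
    rw [hM]
    rfl
  | push r x s =>
    intro emb e hM v
    refine ⟨v, Reach.single ?_⟩
    simp only [Turing.TM2.step]
    rw [hM, stackContents_set]
    rfl
  | @seq p q s₁ s₂ s₃ t₁ t₂ _ _ ih₁ ih₂ =>
    intro emb e hM v
    obtain ⟨v₁, h₁⟩ := ih₁ (fun l => emb (.inl l)) (emb (.inr (Label.entry q)))
      (fun l => hM (.inl l)) v
    obtain ⟨v₂, h₂⟩ := ih₂ (fun l => emb (.inr l)) e (fun l => hM (.inr l)) v₁
    exact ⟨v₂, h₁.trans h₂⟩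
  | @pop r k s s' t _ ih =>
    intro emb e hM v
    obtain ⟨v₁, h₁⟩ := ih (fun l => emb (some ⟨_, l⟩)) e (fun l => hM (some ⟨_, l⟩))
      (s.get r).head?
    refine ⟨v₁, (Reach.mono ((Reach.single ?_).trans h₁) (by omega))⟩
    simp only [Turing.TM2.step]
    rw [hM, stackContents_set]
    rfl
  | @loop_nil r k s hs =>
    intro emb e hM v
    refine ⟨none, Reach.single ?_⟩
    have hst : stackContents i o s = stackContents i o (s.set r []) := by
      rw [← hs]
      cases r <;> rfl
    simp only [Turing.TM2.step]
    rw [hM]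
    conv_rhs => rw [hst, stackContents_set]
    change some (Turing.TM2.Cfg.mk _ (s.get r).head?
      (Function.update (stackContents i o s) (.reg r) (s.get r).tail)) = _
    rw [hs, show stackContents i o s (.reg r) = [] from hs]
    rfl
  | @loop_cons r k s x l s₁ s₂ t₁ t₂ hs _ _ ih₁ ih₂ =>
    intro emb e hM v
    obtain ⟨v₁, h₁⟩ := ih₁ (fun l => emb (some ⟨x, l⟩)) (emb none) (fun l => hM (some ⟨x, l⟩))
      (some x)
    obtain ⟨v₂, h₂⟩ := ih₂ emb e hM v₁
    refine ⟨v₂, ((Reach.single ?_).trans h₁).trans h₂⟩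
    simp only [Turing.TM2.step]
    rw [hM, stackContents_set]
    change some (Turing.TM2.Cfg.mk _ (s.get r).head?
      (Function.update (stackContents i o s) (.reg r) (s.get r).tail)) = _
    rw [hs, show stackContents i o s (.reg r) = x :: l from hs]
    rfl
  | mono _ hle ih =>
    intro emb e hM v
    obtain ⟨v', h'⟩ := ih emb e hM v
    exact ⟨v', h'.mono hle⟩

/-! ### Coding data as bit strings -/

/-- Binary trees, the universal data type of the programs. -/
inductive BTree
  | nil : BTree
  | node (l r : BTree) : BTree

/-- The preorder traversal of a tree, with `true` for a node and `false` for a leaf. This code is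
prefix-free, so that several values can be kept on one stack. -/
def BTree.tokens : BTree → List Bool
  | .nil => [false]
  | .node l r => true :: (l.tokens ++ r.tokens)

theorem BTree.tokens_append_inj : ∀ (t t' : BTree) (r r' : List Bool),
    t.tokens ++ r = t'.tokens ++ r' → t = t' ∧ r = r' := by
  intro t
  induction t with
  | nil =>
    intro t' r r' h
    cases t' <;> simp_all [tokens]
  | node a b iha ihb =>
    intro t' r r' h
    cases t' with
    | nil => simp [tokens] at h
    | node a' b' =>
      simp only [tokens, List.cons_append, List.cons.injEq, true_and, List.append_assoc] at h
      obtain ⟨rfl, h₁⟩ := iha _ _ _ h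
      obtain ⟨rfl, h₂⟩ := ihb _ _ _ h₁
      exact ⟨rfl, h₂⟩

/-- Types whose elements are represented by trees. -/
class Coded (α : Type) where
  /-- The tree that represents an element. -/
  tree : α → BTree
  /-- Different elements are represented by different trees. -/
  tree_injective : Function.Injective tree

/-- The bit string that represents an element of a coded type. -/
def enc {α : Type} [Coded α] (a : α) : List Bool := (Coded.tree a).tokens

/-- The length of the representation. -/
def size {α : Type} [Coded α] (a : α) : ℕ := (enc a).length

/-- The tree of a list: the right spine carries the entries. -/
def listTree {α : Type} [Coded α] : List α → BTree
  | [] => .nil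
  | a :: l => .node (Coded.tree a) (listTree l)

instance : Coded Bool where
  tree b := if b then .node .nil .nil else .nil
  tree_injective a b h := by cases a <;> cases b <;> simp_all

instance : Coded Unit where
  tree _ := .nil
  tree_injective _ _ _ := rfl

instance {α β : Type} [Coded α] [Coded β] : Coded (α × β) where
  tree p := .node (Coded.tree p.1) (Coded.tree p.2)
  tree_injective p q h := by
    simp only [BTree.node.injEq] at h
    exact Prod.ext (Coded.tree_injective h.1) (Coded.tree_injective h.2)

instance {α : Type} [Coded α] : Coded (List α) where
  tree := listTree
  tree_injective l := by
    induction l with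
    | nil => intro l' h; cases l' <;> simp_all [listTree]
    | cons a l ih =>
      intro l' h
      cases l' with
      | nil => simp [listTree] at h
      | cons a' l' =>
        simp only [listTree, BTree.node.injEq] at h
        rw [Coded.tree_injective h.1, ih h.2]

/-- Natural numbers are coded in unary; see `Bin` for the binary code. -/
instance : Coded ℕ where
  tree n := Coded.tree (List.replicate n ())
  tree_injective m n h := by
    simpa using congrArg List.length (Coded.tree_injective h)

/-- The position of a symbol of the input alphabet in a fixed enumeration. -/
def symbolIndex : Γ' → ℕ
  | .blank => 0
  | .bit false => 1
  | .bit true => 2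
  | .bra => 3
  | .ket => 4
  | .comma => 5

instance : Coded Γ' where
  tree x := Coded.tree (symbolIndex x)
  tree_injective x y h := by
    have := Coded.tree_injective h
    rcases x with _ | (_ | _) | _ | _ | _ <;> rcases y with _ | (_ | _) | _ | _ | _ <;>
      simp_all [symbolIndex]

section Size

variable {α β : Type} [Coded α] [Coded β]

theorem enc_append_inj {x y : α} {r r' : List Bool} (h : enc x ++ r = enc y ++ r') :
    x = y ∧ r = r' :=
  let ⟨h₁, h₂⟩ := BTree.tokens_append_inj _ _ _ _ h
  ⟨Coded.tree_injective h₁, h₂⟩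

theorem enc_injective : Function.Injective (enc : α → List Bool) := fun x y h =>
  (enc_append_inj (r := []) (r' := []) (by rw [h])).1

theorem enc_pair (a : α) (b : β) : enc (a, b) = true :: (enc a ++ enc b) := rfl

theorem enc_cons (a : α) (l : List α) : enc (a :: l) = true :: (enc a ++ enc l) := rfl

@[simp]
theorem size_pair (a : α) (b : β) : size (a, b) = size a + size b + 1 := by
  simp [size, enc_pair]

@[simp]
theorem size_nil : size ([] : List α) = 1 := rfl

@[simp]
theorem size_cons (a : α) (l : List α) : size (a :: l) = size a + size l + 1 := by
  simp [size, enc_cons]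

theorem one_le_size (a : α) : 1 ≤ size a := by
  unfold size enc
  cases Coded.tree a <;> simp [BTree.tokens]

theorem length_le_size (l : List α) : 2 * l.length + 1 ≤ size l := by
  induction l with
  | nil => simp
  | cons a l ih =>
    have := one_le_size a
    simp only [List.length_cons, size_cons]
    omega

theorem size_le_of_mem {a : α} {l : List α} (h : a ∈ l) : size a < size l := by
  induction l with
  | nil => simp at h
  | cons b l ih =>
    rcases List.mem_cons.1 h with rfl | h
    · simp only [size_cons]; omega
    · have := ih h
      simp only [size_cons]; omega

theorem size_bool_le (b : Bool) : size b ≤ 3 := by cases b <;> decide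

end Size

theorem eval_mono (q : Polynomial ℕ) {m n : ℕ} (h : m ≤ n) : q.eval m ≤ q.eval n := by
  rw [Polynomial.eval_eq_sum_range, Polynomial.eval_eq_sum_range]
  exact Finset.sum_le_sum fun i _ => Nat.mul_le_mul_left _ (Nat.pow_le_pow_left h i)

/-! ### Moving values between stacks -/

/-- The loop of `take`. The stack `c` holds one symbol for each subtree still to be read. -/
def takeLoop (r : Reg) : Prog :=
  .loop .c fun _ => .pop .main fun o => match o with
    | some true => .push r true ;; .push .c true ;; .push .c true
    | some false => .push r false
    | none => .skip

/-- Move the top value of `main` to `r`, which reverses it. -/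
def take (r : Reg) : Prog := .push .c true ;; takeLoop r

/-- Move the contents of `r` back to `main`, which reverses them. -/
def give (r : Reg) : Prog := .loop r fun x => .push .main x

/-- Empty the stack `r`. -/
def clear (r : Reg) : Prog := .loop r fun _ => .skip

/-- Stated with an arbitrary continuation of the loop, so that it applies to the two subtrees of a
node one after the other. -/
theorem exec_takeLoop {r : Reg} (hm : r ≠ .main) (hc : r ≠ .c) (t : BTree) :
    ∀ {R la lb lc s' T}, Exec (takeLoop r)
        ((⟨R, la, lb, lc⟩ : Store).set r (t.tokens.reverse ++ (⟨R, la, lb, lc⟩ : Store).get r)) s' T →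
      Exec (takeLoop r) ⟨t.tokens ++ R, la, lb, true :: lc⟩ s' (5 * t.tokens.length + T) := by
  induction t with
  | nil =>
    intro R la lb lc s' T h
    refine Exec.mono (Exec.loop_cons (x := true) (l := lc) rfl
      (Exec.pop (t := 1) ?_) h) (t' := _) ?_
    · cases r
      · exact absurd rfl hm
      · exact Exec.push _ _ _
      · exact Exec.push _ _ _
      · exact absurd rfl hc
    · simp only [BTree.tokens, List.length_singleton]
      omega
  | node t₁ t₂ ih₁ ih₂ =>
    intro R la lb lc s' T h
    refine Exec.mono (Exec.loop_cons (x := true) (l := lc)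
      (s₁ := (⟨t₁.tokens ++ (t₂.tokens ++ R), la, lb, true :: true :: lc⟩ : Store).set r
        (true :: (⟨[], la, lb, []⟩ : Store).get r)) (t₂ := 5 * t₁.tokens.length +
          (5 * t₂.tokens.length + T)) rfl
      (Exec.pop (t := 1 + (1 + 1)) ?_) ?_) (t' := _) ?_
    · cases r
      · exact absurd rfl hm
      · simp only [Store.get, Store.set, BTree.tokens, List.cons_append, List.head?_cons,
          List.tail_cons, List.append_assoc]
        exact .seq (.push _ _ _) (.seq (.push _ _ _) (.push _ _ _))
      · simp only [Store.get, Store.set, BTree.tokens, List.cons_append, List.head?_cons,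
          List.tail_cons, List.append_assoc]
        exact .seq (.push _ _ _) (.seq (.push _ _ _) (.push _ _ _))
      · exact absurd rfl hc
    · cases r
      · exact absurd rfl hm
      · refine ih₁ (ih₂ ?_)
        simpa [Store.get, Store.set, BTree.tokens] using h
      · refine ih₁ (ih₂ ?_)
        simpa [Store.get, Store.set, BTree.tokens] using h
      · exact absurd rfl hc
    · simp only [BTree.tokens, List.length_cons, List.length_append]
      omega

section Values

variable {α β : Type} [Coded α] [Coded β]

theorem exec_take_a (x : α) (R la lb : List Bool) :
    Exec (take .a) ⟨enc x ++ R, la, lb, []⟩ ⟨R, (enc x).reverse ++ la, lb, []⟩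
      (5 * size x + 2) := by
  refine Exec.mono (Exec.seq (Exec.push _ _ _) (exec_takeLoop (T := 1) (by decide) (by decide) _
    (Exec.loop_nil rfl))) ?_
  simp only [size, enc]
  omega

theorem exec_take_b (x : α) (R la lb : List Bool) :
    Exec (take .b) ⟨enc x ++ R, la, lb, []⟩ ⟨R, la, (enc x).reverse ++ lb, []⟩
      (5 * size x + 2) := by
  refine Exec.mono (Exec.seq (Exec.push _ _ _) (exec_takeLoop (T := 1) (by decide) (by decide) _
    (Exec.loop_nil rfl))) ?_
  simp only [size, enc]
  omega

theorem exec_give_a (l R lb lc : List Bool) :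
    Exec (give .a) ⟨R, l, lb, lc⟩ ⟨l.reverse ++ R, [], lb, lc⟩ (2 * l.length + 1) := by
  induction l generalizing R with
  | nil => exact Exec.loop_nil rfl
  | cons x l ih =>
    refine Exec.mono (Exec.loop_cons (x := x) (l := l) rfl (Exec.push _ _ _)
      (s₂ := ⟨(x :: l).reverse ++ R, [], lb, lc⟩) (t₂ := 2 * l.length + 1) ?_) ?_
    · simpa using! ih (x :: R)
    · simp only [List.length_cons]; omega

theorem exec_give_b (l R la lc : List Bool) :
    Exec (give .b) ⟨R, la, l, lc⟩ ⟨l.reverse ++ R, la, [], lc⟩ (2 * l.length + 1) := by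
  induction l generalizing R with
  | nil => exact Exec.loop_nil rfl
  | cons x l ih =>
    refine Exec.mono (Exec.loop_cons (x := x) (l := l) rfl (Exec.push _ _ _)
      (s₂ := ⟨(x :: l).reverse ++ R, la, [], lc⟩) (t₂ := 2 * l.length + 1) ?_) ?_
    · simpa using! ih (x :: R)
    · simp only [List.length_cons]; omega

theorem exec_clear (r : Reg) (l : List Bool) (s : Store) (h : s.get r = l) :
    Exec (clear r) s (s.set r []) (2 * l.length + 1) := by
  induction l generalizing s with
  | nil =>
    have : s.set r [] = s := by
      rw [← h]; cases r <;> rfl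
    rw [this]
    exact Exec.loop_nil h
  | cons x l ih =>
    refine Exec.mono (Exec.loop_cons h (Exec.skip _) (s₂ := s.set r []) (t₂ := 2 * l.length + 1)
      ?_) ?_
    · have h₁ := ih (s.set r l) (by cases r <;> rfl)
      have h₂ : (s.set r l).set r [] = s.set r [] := by cases r <;> rfl
      rwa [h₂] at h₁
    · simp only [List.length_cons]; omega

/-- The store with `l` on `main` and empty scratch stacks. -/
def st (l : List Bool) : Store := ⟨l, [], [], []⟩

/-- Discard the top value, using `b` as scratch space. -/
def drop : Prog := take .b ;; clear .b

/-- Duplicate the top value. -/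
def dup : Prog :=
  take .a ;; .loop .a (fun x => .push .main x ;; .push .b x) ;; .loop .b (fun x => .push .a x) ;;
    give .a

/-- Exchange the two topmost values. -/
def swap : Prog := take .a ;; take .b ;; give .a ;; give .b

theorem exec_drop_a (x : α) (R la : List Bool) :
    Exec drop ⟨enc x ++ R, la, [], []⟩ ⟨R, la, [], []⟩ (7 * size x + 3) := by
  refine Exec.mono (Exec.seq (exec_take_b x R la []) (exec_clear .b _ _ rfl)) ?_
  simp only [Store.get, List.append_nil, List.length_reverse, size]
  omega

theorem exec_drop (x : α) (R : List Bool) :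
    Exec drop (st (enc x ++ R)) (st R) (7 * size x + 3) :=
  exec_drop_a x R []

theorem exec_dup (x : α) (R : List Bool) :
    Exec dup (st (enc x ++ R)) (st (enc x ++ (enc x ++ R))) (12 * size x + 5) := by
  have h₁ : ∀ (l R lb : List Bool), Exec (.loop .a fun x => .push .main x ;; .push .b x)
      ⟨R, l, lb, []⟩ ⟨l.reverse ++ R, [], l.reverse ++ lb, []⟩ (3 * l.length + 1) := by
    intro l
    induction l with
    | nil => intro R lb; exact Exec.loop_nil rfl
    | cons x l ih =>
      intro R lb
      refine Exec.mono (Exec.loop_cons (x := x) (l := l) rfl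
        (.seq (Exec.push _ _ _) (Exec.push _ _ _))
        (s₂ := ⟨(x :: l).reverse ++ R, [], (x :: l).reverse ++ lb, []⟩)
        (t₂ := 3 * l.length + 1) ?_) ?_
      · simpa using! ih (x :: R) (x :: lb)
      · simp only [List.length_cons]; omega
  have h₂ : ∀ (l R la : List Bool), Exec (.loop .b fun x => .push .a x)
      ⟨R, la, l, []⟩ ⟨R, l.reverse ++ la, [], []⟩ (2 * l.length + 1) := by
    intro l
    induction l with
    | nil => intro R la; exact Exec.loop_nil rfl
    | cons x l ih =>
      intro R la
      refine Exec.mono (Exec.loop_cons (x := x) (l := l) rfl (Exec.push _ _ _)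
        (s₂ := ⟨R, (x :: l).reverse ++ la, [], []⟩) (t₂ := 2 * l.length + 1) ?_) ?_
      · simpa using! ih R (x :: la)
      · simp only [List.length_cons]; omega
  refine Exec.mono (Exec.seq (exec_take_a x R [] []) (Exec.seq (h₁ _ _ _) (Exec.seq (h₂ _ _ _)
    (s₃ := st (enc x ++ (enc x ++ R))) (t₂ := 2 * size x + 1) ?_))) ?_
  · have := exec_give_a (enc x).reverse (enc x ++ R) [] []
    simpa [size] using! this
  · simp only [List.append_nil, List.length_reverse, size]
    omega

theorem exec_swap (x : α) (y : β) (R : List Bool) :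
    Exec swap (st (enc x ++ (enc y ++ R))) (st (enc y ++ (enc x ++ R)))
      (7 * size x + 7 * size y + 6) := by
  refine Exec.mono (Exec.seq (exec_take_a x _ [] []) (Exec.seq (exec_take_b y R _ [])
    (Exec.seq (exec_give_a _ _ _ _) (s₃ := st (enc y ++ (enc x ++ R))) (t₂ := 2 * size y + 1)
      ?_))) ?_
  · have := exec_give_b (enc y).reverse (enc x ++ R) [] []
    simpa [size] using! this
  · simp only [List.append_nil, List.length_reverse, size]
    omega

end Values

/-! ### Functions computable in polynomial time -/

/-- A function between coded types is computable in polynomial time if some program replaces the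
argument, on top of `main`, by the value, in time polynomial in the size of the argument and
without touching what lies below; the size of the value is polynomially bounded as well. -/
def PTime {α β : Type} [Coded α] [Coded β] (f : α → β) : Prop :=
  ∃ (P : Prog) (q : Polynomial ℕ), ∀ a, size (f a) ≤ q.eval (size a) ∧
    ∀ R, Exec P (st (enc a ++ R)) (st (enc (f a) ++ R)) (q.eval (size a))

namespace PTime

variable {α β γ δ : Type} [Coded α] [Coded β] [Coded γ] [Coded δ]

theorem of_eq {f g : α → β} (hf : PTime f) (h : ∀ a, f a = g a) : PTime g :=
  (funext h : f = g) ▸ hf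

/-- The size of the value is polynomially bounded. -/
theorem size_le {f : α → β} (hf : PTime f) : ∃ q : Polynomial ℕ, ∀ a,
    size (f a) ≤ q.eval (size a) :=
  let ⟨_, q, h⟩ := hf
  ⟨q, fun a => (h a).1⟩

theorem id : PTime (fun a : α => a) :=
  ⟨.skip, X + 1, fun a => ⟨by simp, fun R => Exec.mono (Exec.skip _) (by simp)⟩⟩

/-- Computability only depends on the codes of the values. -/
theorem of_enc_eq {f : α → β} {g : α → γ} (hf : PTime f) (h : ∀ a, enc (g a) = enc (f a)) :
    PTime g := by
  obtain ⟨P, p, hP⟩ := hf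
  refine ⟨P, p, fun a => ?_⟩
  rw [size, h]
  exact hP a

theorem comp {g : β → γ} {f : α → β} (hg : PTime g) (hf : PTime f) :
    PTime fun a => g (f a) := by
  obtain ⟨P, p, hP⟩ := hf
  obtain ⟨Q, q, hQ⟩ := hg
  refine ⟨P ;; Q, p + q.comp p, fun a => ⟨?_, fun R => ?_⟩⟩
  · refine ((hQ (f a)).1.trans (eval_mono q (hP a).1)).trans ?_
    simp
  · refine Exec.mono (Exec.seq ((hP a).2 R) ((hQ (f a)).2 R)) ?_
    simpa using eval_mono q (hP a).1

theorem pair {f : α → β} {g : α → γ} (hf : PTime f) (hg : PTime g) :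
    PTime fun a => (f a, g a) := by
  obtain ⟨P, p, hP⟩ := hf
  obtain ⟨Q, q, hQ⟩ := hg
  refine ⟨dup ;; Q ;; swap ;; P ;; .push .main true, 19 * X + 12 + 2 * p + 8 * q,
    fun a => ⟨?_, fun R => ?_⟩⟩
  · have h₁ := (hP a).1
    have h₂ := (hQ a).1
    simp only [size_pair, Polynomial.eval_add, Polynomial.eval_mul, Polynomial.eval_X,
      Polynomial.eval_ofNat]
    omega
  · refine Exec.mono (Exec.seq (exec_dup a R) (Exec.seq ((hQ a).2 _)
      (Exec.seq (exec_swap (g a) a R) (Exec.seq ((hP a).2 _)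
      (s₃ := st (enc (f a, g a) ++ R)) (t₂ := 1) ?_)))) ?_
    · rw [enc_pair, List.cons_append, List.append_assoc]
      exact Exec.push _ _ _
    · have h₁ := (hP a).1
      have h₂ := (hQ a).1
      simp only [Polynomial.eval_add, Polynomial.eval_mul, Polynomial.eval_X,
        Polynomial.eval_ofNat]
      omega

/-- Pushing the bits of a fixed string, the last one first. -/
theorem exec_pushes (l R : List Bool) :
    Exec (l.foldr (fun x p => p ;; .push .main x) .skip) (st R) (st (l ++ R)) (l.length + 1) := by
  induction l with
  | nil => exact Exec.skip _
  | cons x l ih => exact Exec.mono (Exec.seq ih (Exec.push _ _ _)) (by simp)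

theorem const (b : β) : PTime fun _ : α => b := by
  refine ⟨drop ;; (enc b).foldr (fun x p => p ;; .push .main x) .skip,
    7 * X + 4 + (size b : Polynomial ℕ), fun a => ⟨?_, fun R => ?_⟩⟩
  · simp
  · refine Exec.mono (Exec.seq (exec_drop a R) (exec_pushes _ _)) ?_
    simp [size]
    omega

theorem fst : PTime (Prod.fst : α × β → α) := by
  refine ⟨.pop .main fun _ => take .a ;; drop ;; give .a, 8 * X + 8,
    fun ⟨a, b⟩ => ⟨?_, fun R => Exec.mono (Exec.pop
      (t := 5 * size a + 2 + (7 * size b + 3 + (2 * size a + 1))) ?_) ?_⟩⟩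
  · simp
    omega
  · have h := exec_give_a (enc a).reverse R [] []
    rw [List.reverse_reverse, List.length_reverse] at h
    have h' := exec_drop_a b R (enc a).reverse
    have h'' := exec_take_a a (enc b ++ R) [] []
    rw [List.append_nil] at h''
    rw [enc_pair]
    simp only [st, List.cons_append, Store.get, Store.set, List.tail_cons, List.append_assoc]
    exact h''.seq (h'.seq h)
  · simp
    omega

theorem snd : PTime (Prod.snd : α × β → β) := by
  refine ⟨.pop .main fun _ => drop, 8 * X + 8,
    fun ⟨a, b⟩ => ⟨?_, fun R => Exec.mono (Exec.pop (t := 7 * size a + 3) ?_) ?_⟩⟩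
  · simp
    omega
  · rw [enc_pair]
    simp only [st, List.cons_append, Store.get, Store.set, List.tail_cons, List.append_assoc]
    exact exec_drop _ _
  · simp
    omega

theorem cond {c : α → Bool} {f g : α → β} (hc : PTime c) (hf : PTime f) (hg : PTime g) :
    PTime fun a => if c a then f a else g a := by
  obtain ⟨C, p, hC⟩ := hc
  obtain ⟨P, q, hP⟩ := hf
  obtain ⟨Q, r, hQ⟩ := hg
  refine ⟨dup ;; C ;; .pop .main fun o => match o with
      | some true => .pop .main fun _ => .pop .main fun _ => P
      | _ => Q, 12 * X + 8 + p + q + r, fun a => ⟨?_, fun R => ?_⟩⟩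
  · have h₁ := (hP a).1
    have h₂ := (hQ a).1
    simp only [Polynomial.eval_add, Polynomial.eval_mul, Polynomial.eval_X,
      Polynomial.eval_ofNat]
    split <;> omega
  · refine Exec.mono (Exec.seq (exec_dup a R) (Exec.seq ((hC a).2 _)
      (s₃ := st (enc (if c a then f a else g a) ++ R))
      (t₂ := q.eval (size a) + r.eval (size a) + 3) ?_)) ?_
    · cases c a
      · exact (Exec.pop ((hQ a).2 R)).mono (by omega)
      · exact (Exec.pop (Exec.pop (Exec.pop ((hP a).2 R)))).mono (by omega)
    · simp only [Polynomial.eval_add, Polynomial.eval_mul, Polynomial.eval_X,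
        Polynomial.eval_ofNat]
      omega

/-- Case analysis on a list. -/
theorem listCases {l : α → List β} {f : β × List β × α → γ} {g : α → γ} (hl : PTime l)
    (hg : PTime g) (hf : PTime f) :
    PTime fun a => match l a with
      | [] => g a
      | b :: t => f (b, t, a) := by
  obtain ⟨C, p, hC⟩ := hl
  obtain ⟨P, q, hP⟩ := hf
  obtain ⟨Q, r, hQ⟩ := hg
  refine ⟨dup ;; C ;; .pop .main fun o => match o with
      | some true => take .a ;; .push .main true ;; give .a ;; .push .main true ;; P
      | _ => Q, 12 * X + 20 + 8 * p + r + q.comp (p + X + 1), fun a => ?_⟩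
  have hp := (hC a).1
  have hsize : ∀ {b t}, l a = b :: t → size (b, t, a) ≤ (p + X + 1).eval (size a) := by
    intro b t e
    rw [e] at hp
    simp only [size_cons] at hp
    simp only [size_pair, Polynomial.eval_add, Polynomial.eval_X, Polynomial.eval_one]
    omega
  constructor
  · simp only [Polynomial.eval_add, Polynomial.eval_mul, Polynomial.eval_X,
      Polynomial.eval_ofNat, Polynomial.eval_comp]
    split
    · have := (hQ a).1
      omega
    · rename_i b t e
      have h := ((hP (b, t, a)).1.trans (eval_mono q (hsize e)))
      simp only [Polynomial.eval_add, Polynomial.eval_X, Polynomial.eval_one] at h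
      simp only [Polynomial.eval_one]
      omega
  · intro R
    beta_reduce
    cases e : l a with
    | nil =>
      refine Exec.mono (Exec.seq (exec_dup a R) (Exec.seq ((hC a).2 _)
        (s₃ := st (enc (g a) ++ R)) (t₂ := r.eval (size a) + 1) ?_)) ?_
      · rw [e]
        exact Exec.pop ((hQ a).2 R)
      · simp only [Polynomial.eval_add, Polynomial.eval_mul, Polynomial.eval_X,
          Polynomial.eval_ofNat]
        omega
    | cons b t =>
      have h := (hP (b, t, a)).2 R
      have hq := eval_mono q (hsize e)
      refine Exec.mono (Exec.seq (exec_dup a R) (Exec.seq ((hC a).2 _)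
        (s₃ := st (enc (f (b, t, a)) ++ R))
        (t₂ := (5 * size b + 2 + (1 + (2 * size b + 1 + (1 + q.eval (size (b, t, a)))))) + 1)
        ?_)) ?_
      · rw [e]
        refine Exec.pop ?_
        have h₁ := exec_take_a b (enc t ++ (enc a ++ R)) [] []
        have h₂ := exec_give_a (enc b).reverse (true :: (enc t ++ (enc a ++ R))) [] []
        rw [List.append_nil] at h₁
        rw [List.reverse_reverse, List.length_reverse] at h₂
        simp only [st, enc_cons, List.cons_append, Store.get, List.head?_cons, Store.set,
          List.tail_cons, List.append_assoc]
        refine h₁.seq ((Exec.push _ _ _).seq (h₂.seq ((Exec.push _ _ _).seq ?_)))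
        simpa [enc_pair] using! h
      · rw [e] at hp
        simp only [size_cons] at hp
        simp only [Polynomial.eval_add, Polynomial.eval_mul, Polynomial.eval_X,
          Polynomial.eval_ofNat, Polynomial.eval_comp, Polynomial.eval_one] at hq ⊢
        omega

/-- Iterating a function as many times as a list has entries, as long as the intermediate values
stay polynomially bounded. -/
theorem iterate {l : α → List β} {s : α → γ} {f : γ → γ} (hl : PTime l) (hs : PTime s)
    (hf : PTime f) (B : Polynomial ℕ)
    (hB : ∀ a, ∀ i ≤ (l a).length, size (f^[i] (s a)) ≤ B.eval (size a)) :
    PTime fun a => f^[(l a).length] (s a) := by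
  obtain ⟨S, p, hS⟩ := hl.pair hs
  obtain ⟨P, q, hP⟩ := hf
  let body : Bool → Prog := fun _ => .pop .main fun o => match o with
    | some true => drop ;; swap ;; P ;; swap ;; .push .c true
    | _ => .skip
  refine ⟨S ;; .pop .main fun _ => .push .c true ;; .loop .c body,
    p + 10 + B + p * (21 * p + 21 * B + 25 + q.comp B), fun a => ⟨?_, fun R => ?_⟩⟩
  · refine (hB a _ le_rfl).trans ?_
    simp only [Polynomial.eval_add]
    omega
  · have hp := (hS a).1
    -- `M` bounds the part of the counter that is left, `N` the values of the iteration
    have key : ∀ (M N : ℕ) (l : List β) (x : γ), size l ≤ M →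
        (∀ i ≤ l.length, size (f^[i] x) ≤ N) →
        Exec (.loop .c body) ⟨enc l ++ (enc x ++ R), [], [], [true]⟩
          (st (enc (f^[l.length] x) ++ R))
          (l.length * (21 * M + 21 * N + 25 + q.eval N) + 4) := by
      intro M N l
      induction l with
      | nil =>
        intro x _ _
        refine Exec.mono (Exec.loop_cons (x := true) (l := []) rfl
          (Exec.pop (t := 1) (Exec.skip _)) (Exec.loop_nil rfl)) ?_
        omega
      | cons b l ih =>
        intro x hM hN
        simp only [size_cons] at hM
        have h₀ := hN 0 (Nat.zero_le _)
        have h₁ := hN 1 (by simp)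
        simp only [Function.iterate_zero, id_eq, Function.iterate_one] at h₀ h₁
        have hrec := ih (f x) (by omega) fun i hi => by
          rw [← Function.iterate_succ_apply]
          exact hN (i + 1) (by simpa using hi)
        refine Exec.mono (Exec.loop_cons (x := true) (l := []) rfl
          (Exec.pop (t := 7 * size b + 3 + (7 * size l + 7 * size x + 6 + (q.eval (size x) +
            (7 * size (f x) + 7 * size l + 6 + 1)))) ?_) hrec) ?_
        · rw [enc_cons]
          simp only [List.cons_append, Store.get, List.head?_cons, Store.set,
            List.tail_cons, List.append_assoc]
          exact (exec_drop b _).seq ((exec_swap l x R).seq (((hP x).2 _).seq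
            ((exec_swap (f x) l R).seq (Exec.push _ _ _))))
        · have := eval_mono q h₀
          simp only [List.length_cons]
          rw [Nat.add_mul]
          omega
    have h := key (size (l a)) (B.eval (size a)) (l a) (s a) le_rfl (hB a)
    refine Exec.mono (Exec.seq ((hS a).2 R) (Exec.pop (Exec.seq (Exec.push _ _ _)
      (t₂ := (l a).length * (21 * p.eval (size a) + 21 * B.eval (size a) + 25 +
        q.eval (B.eval (size a))) + 4) ?_))) ?_
    · rw [enc_pair]
      simp only [st, List.cons_append, Store.get, Store.set, List.tail_cons,
        List.append_assoc] at h ⊢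
      refine h.mono ?_
      simp only [size_pair] at hp
      gcongr
      omega
    · have := length_le_size (l a)
      simp only [size_pair] at hp
      simp only [Polynomial.eval_add, Polynomial.eval_mul, Polynomial.eval_ofNat,
        Polynomial.eval_comp]
      have h' : (l a).length ≤ p.eval (size a) := by omega
      have := Nat.mul_le_mul_right (21 * p.eval (size a) + 21 * B.eval (size a) + 25 +
        q.eval (B.eval (size a))) h'
      omega

/-- Equality of two values is decided by comparing their codes symbol by symbol. The stack `c`
records whether a difference has been found. -/
theorem eq [DecidableEq β] {f g : α → β} (hf : PTime f) (hg : PTime g) :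
    PTime fun a => decide (f a = g a) := by
  suffices h : PTime fun p : β × β => decide (p.1 = p.2) from h.comp (hf.pair hg)
  let cmp : Prog := .loop .a fun x => .pop .b fun o =>
    if o = some x then .skip else .push .c true
  have hcmp : ∀ (l l' R lc : List Bool), ∃ l₁ lc₁, (l₁ ++ lc₁ = [] ↔ l = l' ∧ lc = []) ∧
      l₁.length ≤ l'.length ∧ lc₁.length ≤ l.length + lc.length ∧
      Exec cmp ⟨R, l, l', lc⟩ ⟨R, [], l₁, lc₁⟩ (3 * l.length + 1) := by
    intro l
    induction l with
    | nil =>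
      intro l' R lc
      exact ⟨l', lc, by simp [eq_comm], le_rfl, by simp, Exec.loop_nil rfl⟩
    | cons x l ih =>
      intro l' R lc
      by_cases h : l'.head? = some x
      · obtain ⟨l₁, lc₁, h₁, h₂, h₃, h₄⟩ := ih l'.tail R lc
        refine ⟨l₁, lc₁, ?_, ?_, ?_, Exec.mono (Exec.loop_cons (x := x) (l := l) rfl
          (Exec.pop (t := 1) (s' := ⟨R, l, l'.tail, lc⟩) ?_) h₄) ?_⟩
        · rw [h₁]
          cases l' <;> simp_all
        · simp only [List.length_tail] at h₂
          omega
        · simp only [List.length_cons]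
          omega
        · simp only [Store.get, Store.set, h, if_true]
          exact Exec.skip _
        · simp only [List.length_cons]
          omega
      · obtain ⟨l₁, lc₁, h₁, h₂, h₃, h₄⟩ := ih l'.tail R (true :: lc)
        refine ⟨l₁, lc₁, ?_, ?_, ?_, Exec.mono (Exec.loop_cons (x := x) (l := l) rfl
          (Exec.pop (t := 1) (s' := ⟨R, l, l'.tail, true :: lc⟩) ?_) h₄) ?_⟩
        · rw [h₁]
          simp only [reduceCtorEq, and_false, false_iff, not_and]
          rintro rfl
          simp at h
        · simp only [List.length_tail] at h₂
          omega
        · simp only [List.length_cons] at h₃ ⊢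
          omega
        · simp only [Store.get, Store.set, h, if_false]
          exact Exec.push _ _ _
        · simp only [List.length_cons]
          omega
  have hpos : ∀ l R lc : List Bool, Exec (.loop .b fun _ => .push .c true) ⟨R, [], l, lc⟩
      ⟨R, [], [], List.replicate l.length true ++ lc⟩ (2 * l.length + 1) := by
    intro l
    induction l with
    | nil => intro R lc; exact Exec.loop_nil rfl
    | cons x l ih =>
      intro R lc
      refine Exec.mono (Exec.loop_cons (x := x) (l := l) rfl (Exec.push _ _ _)
        (s₂ := ⟨R, [], [], List.replicate (x :: l).length true ++ lc⟩)
        (t₂ := 2 * l.length + 1) ?_) ?_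
      · simpa [List.replicate_succ'] using! ih R (true :: lc)
      · simp only [List.length_cons]; omega
  refine ⟨.pop .main fun _ => take .a ;; take .b ;; cmp ;; (.loop .b fun _ => .push .c true) ;;
    .pop .c fun o => if o = none then
      .push .main false ;; .push .main false ;; .push .main true
      else clear .c ;; .push .main false, 30 * X + 30, fun ⟨x, y⟩ => ⟨?_, fun R => ?_⟩⟩
  · refine (size_bool_le _).trans ?_
    simp
  · obtain ⟨l₁, lc₁, h₁, h₂, h₃, h₄⟩ := hcmp (enc x).reverse (enc y).reverse R []
    have hx := exec_take_a x (enc y ++ R) [] []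
    have hy := exec_take_b y R (enc x).reverse []
    simp only [List.append_nil, List.length_reverse, List.length_nil, Nat.add_zero] at hx hy h₂ h₃
    refine Exec.mono (Exec.pop (Exec.seq (t₁ := 5 * size x + 2)
      (s₂ := ⟨enc y ++ R, (enc x).reverse, [], []⟩) ?_
      (hy.seq (h₄.seq ((hpos l₁ R lc₁).seq
      (Exec.pop (t := 2 * (l₁.length + lc₁.length) + 4) ?_)))))) ?_
    · rw [enc_pair]
      simpa [st, Store.get, Store.set] using! hx
    · by_cases hxy : x = y
      · have : l₁ ++ lc₁ = [] := h₁.2 ⟨by rw [hxy], rfl⟩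
        obtain ⟨rfl, rfl⟩ := List.append_eq_nil_iff.1 this
        simp only [hxy, decide_true]
        exact ((Exec.push _ _ _).seq ((Exec.push _ _ _).seq (Exec.push _ _ _))).mono (by simp)
      · have hne : ¬ l₁ ++ lc₁ = [] := fun h =>
          hxy (enc_injective (List.reverse_injective (h₁.1 h).1))
        simp only [hxy, decide_false]
        have hne' : List.replicate l₁.length true ++ lc₁ ≠ [] := by
          intro h
          apply hne
          simpa using h
        rw [if_neg (by simpa [Store.get] using hne)]
        refine ((exec_clear .c _ _ rfl).seq (Exec.push _ _ _)).mono ?_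
        simp only [Store.get, Store.set, List.length_tail, List.length_append,
          List.length_replicate]
        omega
    · simp only [size_pair, Polynomial.eval_add, Polynomial.eval_mul, Polynomial.eval_X,
        Polynomial.eval_ofNat, List.length_reverse]
      simp only [size] at *
      omega

end PTime

/-! ### Lists -/

section Size

variable {α β : Type} [Coded α] [Coded β]

theorem size_append (l l' : List α) : size (l ++ l') + 1 = size l + size l' := by
  induction l with
  | nil => simp [Nat.add_comm]
  | cons a l ih => simp only [List.cons_append, size_cons]; omega

theorem size_reverse (l : List α) : size l.reverse = size l := by
  induction l with
  | nil => rfl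
  | cons a l ih =>
    have := size_append l.reverse [a]
    simp only [List.reverse_cons, size_cons, size_nil] at *
    omega

theorem size_le_of_suffix {l l' : List α} (h : l' <:+ l) : size l' ≤ size l := by
  obtain ⟨t, rfl⟩ := h
  have := size_append t l'
  have := one_le_size t
  omega

/-- A list whose entries have size at most `B`. -/
theorem size_list_le {l : List α} {B : ℕ} (h : ∀ a ∈ l, size a ≤ B) :
    size l ≤ l.length * (B + 1) + 1 := by
  induction l with
  | nil => simp
  | cons a l ih =>
    have h₁ := h a (by simp)
    have h₂ := ih fun b hb => h b (by simp [hb])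
    simp only [size_cons, List.length_cons, Nat.add_mul]
    omega

theorem enc_nat (n : ℕ) : enc n = enc (List.replicate n ()) := rfl

theorem size_nat (n : ℕ) : size n = 2 * n + 1 := by
  rw [size, enc_nat, ← size]
  induction n with
  | zero => rfl
  | succ n ih =>
    have : size () = 1 := rfl
    rw [List.replicate_succ, size_cons, ih]
    omega

end Size

namespace PTime

variable {α β γ δ : Type} [Coded α] [Coded β] [Coded γ] [Coded δ]

theorem cons {f : α → β} {g : α → List β} (hf : PTime f) (hg : PTime g) :
    PTime fun a => f a :: g a :=
  (hf.pair hg).of_enc_eq fun _ => rfl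

/-- Folds are computable if the intermediate values stay polynomially bounded. -/
theorem foldl {l : α → List β} {i : α → γ} {f : α → γ → β → γ} (hl : PTime l) (hi : PTime i)
    (hf : PTime fun p : α × γ × β => f p.1 p.2.1 p.2.2) (B : Polynomial ℕ)
    (hB : ∀ a, ∀ l', l' <+: l a → size (l'.foldl (f a) (i a)) ≤ B.eval (size a)) :
    PTime fun a => (l a).foldl (f a) (i a) := by
  let step : α × γ × List β → α × γ × List β := fun s => match s.2.2 with
    | [] => s
    | b :: t => (s.1, f s.1 s.2.1 b, t)
  have hstep : PTime step :=
    listCases (f := fun p : β × List β × (α × γ × List β) =>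
        (p.2.2.1, f p.2.2.1 p.2.2.2.1 p.1, p.2.1)) (snd.comp snd) id
      ((fst.comp (snd.comp snd)).pair ((hf.comp ((fst.comp (snd.comp snd)).pair
        ((fst.comp (snd.comp (snd.comp snd))).pair fst))).pair (fst.comp snd)))
  have hiter : ∀ a (k : ℕ), k ≤ (l a).length → step^[k] (a, i a, l a) =
      (a, ((l a).take k).foldl (f a) (i a), (l a).drop k) := by
    intro a k
    induction k with
    | zero => intro _; simp
    | succ k ih =>
      intro hk
      have e := List.drop_eq_getElem_cons (i := k) (l := l a) hk
      rw [Function.iterate_succ_apply', ih (by omega), List.take_add_one,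
        List.getElem?_eq_getElem hk]
      simp only [step]
      rw [e, List.foldl_append]
      rfl
  obtain ⟨q, hq⟩ := hl.size_le
  have h := iterate hl (id.pair (hi.pair hl)) hstep (X + B + q + 2) (fun a k hk => by
    rw [hiter a k hk]
    have h₁ := hB a _ (List.take_prefix k (l a))
    have h₂ := (size_le_of_suffix (List.drop_suffix k (l a))).trans (hq a)
    simp only [size_pair, Polynomial.eval_add, Polynomial.eval_X, Polynomial.eval_ofNat]
    omega)
  refine (fst.comp (snd.comp h)).of_eq fun a => ?_
  rw [hiter a _ le_rfl, List.take_length]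

theorem reverse {l : α → List β} (hl : PTime l) : PTime fun a => (l a).reverse := by
  obtain ⟨q, hq⟩ := hl.size_le
  have h := foldl (f := fun _ s b => b :: s) hl (const ([] : List β))
    ((snd.comp snd).cons (fst.comp snd)) q fun a l' hl' => by
      rw [List.foldl_flip_cons_eq_append', List.append_nil, size_reverse]
      obtain ⟨t, ht⟩ := hl'
      have h₁ := hq a
      have h₂ := size_append l' t
      have := one_le_size t
      rw [ht] at h₂
      omega
  exact h.of_eq fun a => by rw [List.foldl_flip_cons_eq_append', List.append_nil]

theorem foldr {l : α → List β} {i : α → γ} {f : α → β → γ → γ} (hl : PTime l) (hi : PTime i)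
    (hf : PTime fun p : α × β × γ => f p.1 p.2.1 p.2.2) (B : Polynomial ℕ)
    (hB : ∀ a, ∀ l', l' <:+ l a → size (l'.foldr (f a) (i a)) ≤ B.eval (size a)) :
    PTime fun a => (l a).foldr (f a) (i a) := by
  refine (foldl (f := fun a s b => f a b s) hl.reverse hi
    (hf.comp (fst.pair ((snd.comp snd).pair (fst.comp snd)))) B fun a l' hl' => ?_).of_eq
    fun a => by rw [List.foldl_reverse]
  rw [← List.reverse_reverse l', List.foldl_reverse]
  exact hB a _ (by rw [← List.reverse_prefix, List.reverse_reverse]; exact hl')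

/-- Folds are computable if each step increases the size by a polynomially bounded amount. -/
theorem foldr_of_add {l : α → List β} {i : α → γ} {f : α → β → γ → γ} (hl : PTime l)
    (hi : PTime i) (hf : PTime fun p : α × β × γ => f p.1 p.2.1 p.2.2) (g : Polynomial ℕ)
    (hg : ∀ a, ∀ b ∈ l a, ∀ s, size (f a b s) ≤ size s + g.eval (size a)) :
    PTime fun a => (l a).foldr (f a) (i a) := by
  obtain ⟨q, hq⟩ := hl.size_le
  obtain ⟨r, hr⟩ := hi.size_le
  refine foldr hl hi hf (r + q * g) fun a l' hl' => ?_
  have h₁ : size (l'.foldr (f a) (i a)) ≤ size (i a) + l'.length * g.eval (size a) := by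
    have hmem : ∀ b ∈ l', b ∈ l a := fun b hb => hl'.mem hb
    clear hl'
    induction l' with
    | nil => simp
    | cons b l' ih =>
      have h := hg a b (hmem b (by simp)) (l'.foldr (f a) (i a))
      have := ih fun b hb => hmem b (by simp [hb])
      simp only [List.foldr_cons, List.length_cons, Nat.add_mul]
      omega
  have h₂ : l'.length ≤ q.eval (size a) := by
    have := hq a
    have := length_le_size (l a)
    have := hl'.length_le
    omega
  have h₃ := Nat.mul_le_mul_right (g.eval (size a)) h₂
  have := hr a
  simp only [Polynomial.eval_add, Polynomial.eval_mul]
  omega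

theorem map {l : α → List β} {f : α → β → γ} (hl : PTime l)
    (hf : PTime fun p : α × β => f p.1 p.2) : PTime fun a => (l a).map (f a) := by
  obtain ⟨q, hq⟩ := hl.size_le
  obtain ⟨r, hr⟩ := hf.size_le
  refine (foldr_of_add (f := fun a b s => f a b :: s) hl (const ([] : List γ))
    (cons (hf.comp (fst.pair (fst.comp snd))) (snd.comp snd)) (r.comp (X + q + 1) + 1)
    fun a b hb s => ?_).of_eq fun a => by
      induction l a with
      | nil => rfl
      | cons b t ih => rw [List.foldr_cons, ih, List.map_cons]
  have h₁ : size (f a b) ≤ r.eval (size (a, b)) := hr (a, b)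
  have h₂ := eval_mono r (m := size (a, b)) (n := size a + q.eval (size a) + 1) (by
    have := size_le_of_mem hb
    have := hq a
    rw [size_pair]
    omega)
  simp only [size_cons, Polynomial.eval_add, Polynomial.eval_comp, Polynomial.eval_X,
    Polynomial.eval_one]
  omega

theorem append {l l' : α → List β} (hl : PTime l) (hl' : PTime l') :
    PTime fun a => l a ++ l' a := by
  obtain ⟨q, hq⟩ := hl.size_le
  refine (foldr_of_add (f := fun _ b s => b :: s) hl hl' ((fst.comp snd).cons (snd.comp snd))
    (q + 1) fun a b hb s => ?_).of_eq fun a => by simp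
  have := size_le_of_mem hb
  have := hq a
  simp only [size_cons, Polynomial.eval_add, Polynomial.eval_one]
  omega

theorem flatMap {l : α → List β} {f : α → β → List γ} (hl : PTime l)
    (hf : PTime fun p : α × β => f p.1 p.2) : PTime fun a => (l a).flatMap (f a) := by
  obtain ⟨q, hq⟩ := hl.size_le
  obtain ⟨r, hr⟩ := hf.size_le
  refine (foldr_of_add (f := fun a b s => f a b ++ s) hl (const ([] : List γ))
    (append (hf.comp (fst.pair (fst.comp snd))) (snd.comp snd)) (r.comp (X + q + 1))
    fun a b hb s => ?_).of_eq fun a => by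
      induction l a with
      | nil => rfl
      | cons b t ih => rw [List.foldr_cons, ih, List.flatMap_cons]
  have h₁ : size (f a b) ≤ r.eval (size (a, b)) := hr (a, b)
  have h₂ := eval_mono r (m := size (a, b)) (n := size a + q.eval (size a) + 1) (by
    have := size_le_of_mem hb
    have := hq a
    rw [size_pair]
    omega)
  have h₃ := size_append (f a b) s
  simp only [Polynomial.eval_add, Polynomial.eval_comp, Polynomial.eval_X,
    Polynomial.eval_one]
  omega

theorem and {f g : α → Bool} (hf : PTime f) (hg : PTime g) : PTime fun a => f a && g a :=
  (hf.cond hg (const false)).of_eq fun a => by cases f a <;> rfl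

theorem or {f g : α → Bool} (hf : PTime f) (hg : PTime g) : PTime fun a => f a || g a :=
  (hf.cond (const true) hg).of_eq fun a => by cases f a <;> rfl

theorem not {f : α → Bool} (hf : PTime f) : PTime fun a => !f a :=
  (hf.cond (const false) (const true)).of_eq fun a => by cases f a <;> rfl

theorem xor {f g : α → Bool} (hf : PTime f) (hg : PTime g) : PTime fun a => f a ^^ g a :=
  (hf.cond hg.not hg).of_eq fun a => by cases f a <;> cases g a <;> rfl

theorem all {l : α → List β} {f : α → β → Bool} (hl : PTime l)
    (hf : PTime fun p : α × β => f p.1 p.2) : PTime fun a => (l a).all (f a) := by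
  refine (foldr (f := fun a b s => f a b && s) hl (const true)
    (and (hf.comp (fst.pair (fst.comp snd))) (snd.comp snd)) 3
    fun a l' _ => (size_bool_le _).trans (by simp)).of_eq fun a => ?_
  induction l a with
  | nil => rfl
  | cons b t ih => rw [List.foldr_cons, ih, List.all_cons]

theorem any {l : α → List β} {f : α → β → Bool} (hl : PTime l)
    (hf : PTime fun p : α × β => f p.1 p.2) : PTime fun a => (l a).any (f a) :=
  (hl.all hf.not).not.of_eq fun a => by
    induction l a with
    | nil => rfl
    | cons b t ih => rw [List.all_cons, List.any_cons, Bool.not_and, ih, Bool.not_not]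

theorem length {l : α → List β} (hl : PTime l) : PTime fun a => (l a).length :=
  (hl.map (f := fun _ _ => ()) (const ())).of_enc_eq fun a => by rw [enc_nat]; simp

theorem replicate {n : α → ℕ} {f : α → β} (hn : PTime n) (hf : PTime f) :
    PTime fun a => List.replicate (n a) (f a) := by
  have h : PTime fun a => List.replicate (n a) () := hn.of_enc_eq fun _ => rfl
  exact (h.map (f := fun a _ => f a) (hf.comp fst)).of_eq fun a => by simp

theorem range {n : α → ℕ} (hn : PTime n) : PTime fun a => List.range (n a) := by
  have key : ∀ l : List Unit,
      l.foldl (fun s _ => s ++ [s.length]) ([] : List ℕ) = List.range l.length := by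
    intro l
    induction l using List.reverseRecOn with
    | nil => rfl
    | append_singleton l b ih => simp [List.foldl_append, ih, List.range_succ]
  obtain ⟨q, hq⟩ := hn.size_le
  refine (foldl (f := fun _ s _ => s ++ [s.length]) (hn.replicate (const ())) (const ([] : List ℕ))
    ((fst.comp snd).append ((fst.comp snd).length.cons (const []))) (q * (2 * q + 2) + 1)
    fun a l' hl' => ?_).of_eq fun a => by rw [key, List.length_replicate]
  have h₁ := hq a
  have h₂ := hl'.length_le
  rw [List.length_replicate] at h₂
  rw [size_nat] at h₁
  have h₃ : l'.length ≤ q.eval (size a) := by omega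
  rw [key]
  refine (size_list_le (B := 2 * q.eval (size a) + 1) fun k hk => ?_).trans ?_
  · rw [List.mem_range] at hk
    rw [size_nat]
    omega
  · simp only [List.length_range, Polynomial.eval_add, Polynomial.eval_mul,
      Polynomial.eval_ofNat, Polynomial.eval_one]
    exact Nat.add_le_add_right (Nat.mul_le_mul h₃ (by omega)) 1

theorem tail {l : α → List β} (hl : PTime l) : PTime fun a => (l a).tail :=
  (listCases (f := fun p => p.2.1) hl (const ([] : List β)) (fst.comp snd)).of_eq fun a => by
    cases l a <;> rfl

theorem headD {l : α → List β} {f : α → β} (hl : PTime l) (hf : PTime f) :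
    PTime fun a => (l a).headD (f a) :=
  (listCases (f := fun p => p.1) hl hf fst).of_eq fun a => by cases l a <;> rfl

theorem getD {l : α → List β} {n : α → ℕ} {f : α → β} (hl : PTime l) (hn : PTime n)
    (hf : PTime f) : PTime fun a => (l a).getD (n a) (f a) := by
  have key : ∀ (k : ℕ) (l : List β), List.tail^[k] l = l.drop k := by
    intro k
    induction k with
    | zero => intro l; rfl
    | succ k ih => intro l; rw [Function.iterate_succ_apply, ih]; simp
  obtain ⟨q, hq⟩ := hl.size_le
  refine ((iterate (hn.replicate (const ())) hl (f := List.tail) (tail id) q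
    fun a i _ => ?_).headD hf).of_eq fun a => ?_
  · rw [key]
    exact (size_le_of_suffix (List.drop_suffix _ _)).trans (hq a)
  · rw [key, List.length_replicate]
    simp [List.headD_eq_head?_getD, List.getD_eq_getElem?_getD]

end PTime

/-! ### Arithmetic in binary -/

/-- Natural numbers, to be coded in binary. -/
structure Bin where
  /-- The number itself. -/
  val : ℕ

/-- A binary number is coded as the list of its bits, the lowest first, without leading zeros. -/
instance : Coded Bin where
  tree n := Coded.tree n.val.bits
  tree_injective m n h := by
    have h := Coded.tree_injective h
    obtain ⟨m⟩ := m
    obtain ⟨n⟩ := n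
    have key : ∀ (m n : ℕ), m.bits = n.bits → m = n := by
      intro m
      induction m using Nat.strong_induction_on with
      | _ m ih =>
        intro n h
        have hb : m.bodd = n.bodd := by rw [Nat.bodd_eq_bits_head, h, Nat.bodd_eq_bits_head]
        have hd : m.div2.bits = n.div2.bits := by
          rw [Nat.div2_bits_eq_tail, h, Nat.div2_bits_eq_tail]
        rcases Nat.eq_zero_or_pos m with rfl | hm
        · have := congrArg List.length h
          rw [Nat.size_eq_bits_len, Nat.size_eq_bits_len, Nat.size_zero] at this
          exact (Nat.size_eq_zero.1 this.symm).symm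
        · have h₂ := ih m.div2 (by rw [Nat.div2_val]; omega) _ hd
          rw [← Nat.bodd_add_div2 m, ← Nat.bodd_add_div2 n, hb, h₂]
    exact congrArg Bin.mk (key m n h)

theorem enc_bin (n : Bin) : enc n = enc n.val.bits := rfl

theorem size_bin_le (n : ℕ) : size (Bin.mk n) ≤ 4 * n.size + 1 := by
  have h := size_list_le (l := n.bits) (B := 3) fun b _ => size_bool_le b
  rw [Nat.size_eq_bits_len] at h
  have h' : size (Bin.mk n) = size n.bits := rfl
  omega

theorem le_size_bin (n : ℕ) : 2 * n.size + 1 ≤ size (Bin.mk n) := by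
  have h := length_le_size n.bits
  rw [Nat.size_eq_bits_len] at h
  exact h

theorem natSize_add_le (m n : ℕ) : (m + n).size ≤ m.size + n.size + 1 := by
  rw [Nat.size_le]
  have h₁ := Nat.lt_size_self m
  have h₂ := Nat.lt_size_self n
  have h₃ : 2 ^ m.size ≤ 2 ^ (m.size + n.size) := Nat.pow_le_pow_right (by norm_num) (by omega)
  have h₄ : 2 ^ n.size ≤ 2 ^ (m.size + n.size) := Nat.pow_le_pow_right (by norm_num) (by omega)
  rw [pow_succ]
  omega

theorem natSize_mul_le (m n : ℕ) : (m * n).size ≤ m.size + n.size := by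
  rw [Nat.size_le, pow_add]
  exact Nat.mul_lt_mul'' (Nat.lt_size_self m) (Nat.lt_size_self n)

/-- The carry of the addition of three bits. -/
def majority (x y z : Bool) : Bool := if x then y || z else y && z

theorem bit_add (m n : ℕ) (c : Bool) :
    m + n + c.toNat = Nat.bit (m.bodd ^^ (n.bodd ^^ c))
      (m.div2 + n.div2 + (majority m.bodd n.bodd c).toNat) := by
  conv_lhs => rw [← Nat.bodd_add_div2 m, ← Nat.bodd_add_div2 n]
  rw [Nat.bit_val]
  cases m.bodd <;> cases n.bodd <;> cases c <;> simp [majority] <;> omega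

/-- The state of the addition: what is left of the two summands, the carry, and the digits of the
sum found so far. -/
abbrev AddState : Type := Bin × Bin × Bool × List Bool

/-- One step of the addition. -/
def addStep (s : AddState) : AddState :=
  (⟨s.1.val.div2⟩, ⟨s.2.1.val.div2⟩, majority s.1.val.bodd s.2.1.val.bodd s.2.2.1,
    (s.1.val.bodd ^^ (s.2.1.val.bodd ^^ s.2.2.1)) :: s.2.2.2)

/-- The invariant of the addition: writing the digits found so far below the sum of what is left
gives the same number throughout. -/
theorem addStep_iterate (k : ℕ) (s : AddState) :
    (addStep^[k] s).1.val = s.1.val / 2 ^ k ∧ (addStep^[k] s).2.1.val = s.2.1.val / 2 ^ k ∧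
    (addStep^[k] s).2.2.2.length = s.2.2.2.length + k ∧
    (addStep^[k] s).2.2.2.foldl (fun n b => Nat.bit b n) ((addStep^[k] s).1.val +
      (addStep^[k] s).2.1.val + (addStep^[k] s).2.2.1.toNat) =
    s.2.2.2.foldl (fun n b => Nat.bit b n) (s.1.val + s.2.1.val + s.2.2.1.toNat) := by
  induction k with
  | zero => simp
  | succ k ih =>
    obtain ⟨h₁, h₂, h₃, h₄⟩ := ih
    rw [Function.iterate_succ_apply']
    refine ⟨?_, ?_, ?_, ?_⟩
    · simp only [addStep, h₁, Nat.div2_val, Nat.div_div_eq_div_mul, pow_succ]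
    · simp only [addStep, h₂, Nat.div2_val, Nat.div_div_eq_div_mul, pow_succ]
    · simp only [addStep, List.length_cons, h₃]
      omega
    · rw [← h₄, bit_add (addStep^[k] s).1.val]
      rfl

/-- Once both summands are used up, one more step clears the carry. -/
theorem addStep_iterate_add (m n k : ℕ) (hm : m.size ≤ k) (hn : n.size ≤ k) :
    (addStep^[k + 1] (⟨m⟩, ⟨n⟩, false, [])).2.2.2.foldl (fun n b => Nat.bit b n) 0 = m + n := by
  have h := addStep_iterate (k + 1) (⟨m⟩, ⟨n⟩, false, [])
  have h' := addStep_iterate k (⟨m⟩, ⟨n⟩, false, [])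
  obtain ⟨h₁, h₂, -, h₄⟩ := h
  have hm' : m / 2 ^ (k + 1) = 0 :=
    Nat.div_eq_of_lt (Nat.size_le.1 (by omega))
  have hn' : n / 2 ^ (k + 1) = 0 :=
    Nat.div_eq_of_lt (Nat.size_le.1 (by omega))
  have hc : (addStep^[k + 1] (⟨m⟩, ⟨n⟩, false, [])).2.2.1 = false := by
    rw [Function.iterate_succ_apply']
    simp only [addStep, h'.1, h'.2.1, Nat.div_eq_of_lt (Nat.size_le.1 hm),
      Nat.div_eq_of_lt (Nat.size_le.1 hn), majority, Nat.bodd_zero, Bool.false_and,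
      Bool.false_eq_true, if_false]
  rw [h₁, h₂, hc] at h₄
  simpa [hm', hn'] using h₄

/-- One step of the comparison. The state holds what is left of the two numbers, and whether the part
of the first number already read is at most that of the second. -/
def leStep (s : Bin × Bin × Bool) : Bin × Bin × Bool :=
  (⟨s.1.val.div2⟩, ⟨s.2.1.val.div2⟩,
    if s.1.val.bodd then s.2.1.val.bodd && s.2.2 else s.2.1.val.bodd || s.2.2)

/-- The invariant of the comparison: the lexicographic comparison of what is left and of what has
been read. -/
theorem leStep_iterate (k : ℕ) (s : Bin × Bin × Bool) :
    (leStep^[k] s).1.val = s.1.val / 2 ^ k ∧ (leStep^[k] s).2.1.val = s.2.1.val / 2 ^ k ∧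
    (((leStep^[k] s).1.val < (leStep^[k] s).2.1.val ∨
      (leStep^[k] s).1.val = (leStep^[k] s).2.1.val ∧ (leStep^[k] s).2.2 = true) ↔
      (s.1.val < s.2.1.val ∨ s.1.val = s.2.1.val ∧ s.2.2 = true)) := by
  induction k with
  | zero => simp
  | succ k ih =>
    obtain ⟨h₁, h₂, h₃⟩ := ih
    rw [Function.iterate_succ_apply']
    refine ⟨?_, ?_, ?_⟩
    · simp only [leStep, h₁, Nat.div2_val, Nat.div_div_eq_div_mul, pow_succ]
    · simp only [leStep, h₂, Nat.div2_val, Nat.div_div_eq_div_mul, pow_succ]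
    · rw [← h₃]
      generalize leStep^[k] s = u
      obtain ⟨⟨m⟩, ⟨n⟩, r⟩ := u
      have hm := Nat.bodd_add_div2 m
      have hn := Nat.bodd_add_div2 n
      simp only [leStep]
      cases h : m.bodd <;> cases h' : n.bodd <;> rw [h] at hm <;> rw [h'] at hn <;>
        cases r <;> simp at hm hn ⊢ <;> omega

/-- A number-valued function whose values can be computed in binary in polynomial time. -/
def PTimeBin {α : Type} [Coded α] (f : α → ℕ) : Prop := PTime fun a => Bin.mk (f a)

namespace PTime

variable {α β : Type} [Coded α] [Coded β]

theorem majority {f g h : α → Bool} (hf : PTime f) (hg : PTime g) (hh : PTime h) :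
    PTime fun a => majority (f a) (g a) (h a) :=
  hf.cond (hg.or hh) (hg.and hh)

end PTime

namespace PTimeBin

variable {α β : Type} [Coded α] [Coded β]

theorem of_eq {f g : α → ℕ} (hf : PTimeBin f) (h : ∀ a, f a = g a) : PTimeBin g :=
  (funext h : f = g) ▸ hf

theorem comp {f : β → ℕ} {g : α → β} (hf : PTimeBin f) (hg : PTime g) :
    PTimeBin fun a => f (g a) :=
  PTime.comp (g := fun b => Bin.mk (f b)) hf hg

theorem bits {f : α → ℕ} (hf : PTimeBin f) : PTime fun a => (f a).bits :=
  PTime.of_enc_eq hf fun _ => rfl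

theorem bodd {f : α → ℕ} (hf : PTimeBin f) : PTime fun a => (f a).bodd :=
  (hf.bits.headD (PTime.const false)).of_eq fun a => by
    rw [Nat.bodd_eq_bits_head]
    cases (f a).bits <;> rfl

theorem const (n : ℕ) : PTimeBin fun _ : α => n := PTime.const _

theorem val {f : α → Bin} (hf : PTime f) : PTimeBin fun a => (f a).val := hf

theorem cond {c : α → Bool} {f g : α → ℕ} (hc : PTime c) (hf : PTimeBin f) (hg : PTimeBin g) :
    PTimeBin fun a => if c a then f a else g a :=
  (PTime.cond hc hf hg).of_eq fun a => by beta_reduce; split <;> rfl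

theorem div2 {f : α → ℕ} (hf : PTimeBin f) : PTimeBin fun a => (f a).div2 :=
  (hf.bits.tail).of_enc_eq fun a => by rw [enc_bin, Nat.div2_bits_eq_tail]

theorem bit {b : α → Bool} {f : α → ℕ} (hb : PTime b) (hf : PTimeBin f) :
    PTimeBin fun a => Nat.bit (b a) (f a) := by
  have h := PTime.listCases (f := fun p : Bool × List Bool × α => b p.2.2 :: (f p.2.2).bits)
    hf.bits (hb.cond (PTime.const [true]) (PTime.const []))
    ((hb.comp (PTime.snd.comp PTime.snd)).cons (hf.bits.comp (PTime.snd.comp PTime.snd)))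
  refine h.of_enc_eq fun a => ?_
  rw [enc_bin]
  congr 1
  split
  · rename_i e
    have h0 : f a = 0 := by
      rw [← Nat.size_eq_zero, ← Nat.size_eq_bits_len, e, List.length_nil]
    change (Nat.bit (b a) (f a)).bits = _
    rw [h0]
    cases b a <;> simp [Nat.bit]
  · rename_i e
    refine Nat.bits_append_bit _ _ fun h0 => ?_
    rw [h0, Nat.zero_bits] at e
    cases e

/-- The size of a fold of `Nat.bit` over a list of digits. -/
theorem natSize_foldl_bit_le (l : List Bool) (n : ℕ) :
    (l.foldl (fun n b => Nat.bit b n) n).size ≤ n.size + l.length := by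
  induction l generalizing n with
  | nil => simp
  | cons b l ih =>
    refine (ih _).trans ?_
    have : (Nat.bit b n).size ≤ n.size + 1 := by
      by_cases h : Nat.bit b n = 0
      · simp [h]
      · rw [Nat.size_bit h]
    simp only [List.length_cons]
    omega

theorem ofDigits {l : α → List Bool} (hl : PTime l) :
    PTimeBin fun a => (l a).foldl (fun n b => Nat.bit b n) 0 := by
  obtain ⟨q, hq⟩ := hl.size_le
  have key : ∀ (l : List Bool) (n : ℕ), (l.foldl (fun s b => Bin.mk (Nat.bit b s.val)) ⟨n⟩) =
      ⟨l.foldl (fun n b => Nat.bit b n) n⟩ := by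
    intro l
    induction l with
    | nil => intro n; rfl
    | cons b l ih => intro n; exact ih _
  refine (PTime.foldl (f := fun _ s b => Bin.mk (Nat.bit b s.val)) hl (PTime.const ⟨0⟩)
    (bit (PTime.snd.comp PTime.snd) (val (PTime.fst.comp PTime.snd))) (4 * q + 1)
    fun a l' hl' => ?_).of_eq fun a => key _ _
  rw [key]
  refine (size_bin_le _).trans ?_
  have h₁ := natSize_foldl_bit_le l' 0
  have h₂ := length_le_size (l a)
  have h₃ := hq a
  have h₄ := hl'.length_le
  simp only [Nat.size_zero, Polynomial.eval_add, Polynomial.eval_mul, Polynomial.eval_ofNat,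
    Polynomial.eval_one] at *
  omega

theorem add {f g : α → ℕ} (hf : PTimeBin f) (hg : PTimeBin g) :
    PTimeBin fun a => f a + g a := by
  obtain ⟨p, hp⟩ := hf.size_le
  obtain ⟨q, hq⟩ := hg.size_le
  have hstep : PTime addStep := by
    have hx : PTimeBin fun s : AddState => s.1.val := val PTime.fst
    have hy : PTimeBin fun s : AddState => s.2.1.val := val (PTime.fst.comp PTime.snd)
    have hc : PTime fun s : AddState => s.2.2.1 :=
      PTime.fst.comp (PTime.snd.comp PTime.snd)
    have hl : PTime fun s : AddState => s.2.2.2 :=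
      PTime.snd.comp (PTime.snd.comp PTime.snd)
    exact PTime.pair hx.div2 (PTime.pair hy.div2 ((PTime.majority hx.bodd hy.bodd hc).pair
      ((hx.bodd.xor (hy.bodd.xor hc)).cons hl)))
  have hN : PTime fun a => false :: ((f a).bits ++ (g a).bits) :=
    (PTime.const false).cons (hf.bits.append hg.bits)
  have hlen : ∀ a, (false :: ((f a).bits ++ (g a).bits)).length =
      (f a).size + (g a).size + 1 := by
    intro a
    simp [Nat.size_eq_bits_len]
  have h := PTime.iterate (s := fun a => ((⟨f a⟩, ⟨g a⟩, false, []) : AddState)) hN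
    (PTime.pair hf (PTime.pair hg (PTime.const (false, [])))) hstep
    (4 * p + 4 * q + 4 * (p + q + 1) + 10) (fun a i hi => by
      obtain ⟨h₁, h₂, h₃, -⟩ := addStep_iterate i (⟨f a⟩, ⟨g a⟩, false, [])
      rw [hlen] at hi
      generalize addStep^[i] (⟨f a⟩, ⟨g a⟩, false, []) = u at *
      obtain ⟨⟨m⟩, ⟨n⟩, c, l⟩ := u
      simp only [List.length_nil, Nat.zero_add] at h₁ h₂ h₃
      have hm : m.size ≤ (f a).size := Nat.size_le_size (h₁ ▸ Nat.div_le_self _ _)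
      have hn : n.size ≤ (g a).size := Nat.size_le_size (h₂ ▸ Nat.div_le_self _ _)
      have h₄ := size_bin_le m
      have h₅ := size_bin_le n
      have h₆ := size_list_le (l := l) (B := 3) fun b _ => size_bool_le b
      have h₇ := size_bool_le c
      have h₈ := le_size_bin (f a)
      have h₉ := le_size_bin (g a)
      have h₁₀ := hp a
      have h₁₁ := hq a
      simp only [size_pair, Polynomial.eval_add, Polynomial.eval_mul, Polynomial.eval_ofNat,
        Polynomial.eval_one]
      omega)
  have hout : PTime fun s : AddState => s.2.2.2 := PTime.snd.comp (PTime.snd.comp PTime.snd)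
  refine (ofDigits (hout.comp h)).of_eq fun a => ?_
  rw [hlen]
  exact addStep_iterate_add _ _ _ (by omega) (by omega)

theorem le {f g : α → ℕ} (hf : PTimeBin f) (hg : PTimeBin g) :
    PTime fun a => decide (f a ≤ g a) := by
  obtain ⟨p, hp⟩ := hf.size_le
  obtain ⟨q, hq⟩ := hg.size_le
  have hstep : PTime leStep := by
    have hx : PTimeBin fun s : Bin × Bin × Bool => s.1.val := val PTime.fst
    have hy : PTimeBin fun s : Bin × Bin × Bool => s.2.1.val := val (PTime.fst.comp PTime.snd)
    have hc : PTime fun s : Bin × Bin × Bool => s.2.2 := PTime.snd.comp PTime.snd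
    exact PTime.pair hx.div2 (PTime.pair hy.div2
      (hx.bodd.cond (hy.bodd.and hc) (hy.bodd.or hc)))
  have hlen : ∀ a, ((f a).bits ++ (g a).bits).length = (f a).size + (g a).size := by
    intro a
    simp [Nat.size_eq_bits_len]
  have h := PTime.iterate (s := fun a => ((⟨f a⟩, ⟨g a⟩, true) : Bin × Bin × Bool))
    (hf.bits.append hg.bits) (PTime.pair hf (PTime.pair hg (PTime.const true))) hstep
    (4 * p + 4 * q + 10) (fun a i hi => by
      obtain ⟨h₁, h₂, -⟩ := leStep_iterate i (⟨f a⟩, ⟨g a⟩, true)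
      generalize leStep^[i] (⟨f a⟩, ⟨g a⟩, true) = u at *
      obtain ⟨⟨m⟩, ⟨n⟩, c⟩ := u
      simp only at h₁ h₂
      have hm : m.size ≤ (f a).size := Nat.size_le_size (h₁ ▸ Nat.div_le_self _ _)
      have hn : n.size ≤ (g a).size := Nat.size_le_size (h₂ ▸ Nat.div_le_self _ _)
      have h₄ := size_bin_le m
      have h₅ := size_bin_le n
      have h₇ := size_bool_le c
      have h₈ := le_size_bin (f a)
      have h₉ := le_size_bin (g a)
      have h₁₀ := hp a
      have h₁₁ := hq a
      simp only [size_pair, Polynomial.eval_add, Polynomial.eval_mul, Polynomial.eval_ofNat]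
      omega)
  have hout : PTime fun s : Bin × Bin × Bool => s.2.2 := PTime.snd.comp PTime.snd
  refine (hout.comp h).of_eq fun a => ?_
  rw [hlen]
  obtain ⟨h₁, h₂, h₃⟩ := leStep_iterate ((f a).size + (g a).size) (⟨f a⟩, ⟨g a⟩, true)
  have hm : f a / 2 ^ ((f a).size + (g a).size) = 0 :=
    Nat.div_eq_of_lt (Nat.size_le.1 (by omega))
  have hn : g a / 2 ^ ((f a).size + (g a).size) = 0 :=
    Nat.div_eq_of_lt (Nat.size_le.1 (by omega))
  rw [h₁, h₂, hm, hn] at h₃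
  rw [Bool.eq_iff_iff, decide_eq_true_iff, le_iff_lt_or_eq]
  simpa using h₃

theorem foldr_bit_bits (n : ℕ) : n.bits.foldr (fun b n => Nat.bit b n) 0 = n := by
  induction n using Nat.binaryRec' with
  | zero => simp
  | bit b n h ih => rw [Nat.bits_append_bit n b h, List.foldr_cons, ih]

theorem mul {f g : α → ℕ} (hf : PTimeBin f) (hg : PTimeBin g) :
    PTimeBin fun a => f a * g a := by
  obtain ⟨p, hp⟩ := hf.size_le
  obtain ⟨q, hq⟩ := hg.size_le
  let step : α → Bool → Bin → Bin := fun a b s => ⟨(if b then f a else 0) + Nat.bit false s.val⟩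
  have hstep : PTime fun x : α × Bool × Bin => step x.1 x.2.1 x.2.2 :=
    (cond (PTime.fst.comp PTime.snd) (hf.comp PTime.fst) (const 0)).add
      (bit (PTime.const false) (val (PTime.snd.comp PTime.snd)))
  have hstep_foldr : ∀ a (l : List Bool), l.foldr (step a) ⟨0⟩ =
      ⟨f a * l.foldr (fun b n => Nat.bit b n) 0⟩ := by
    intro a l
    induction l with
    | nil => rfl
    | cons b l ih =>
      rw [List.foldr_cons, List.foldr_cons, ih]
      cases b <;> simp [step, Nat.bit_val] <;> ring
  refine (PTime.foldr (f := step) hg.bits (PTime.const ⟨0⟩) hstep (4 * p + 4 * q + 1)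
    fun a l hl => ?_).of_eq fun a => by rw [hstep_foldr, foldr_bit_bits]
  rw [hstep_foldr]
  refine (size_bin_le _).trans ?_
  have h₁ := natSize_mul_le (f a) (l.foldr (fun b n => Nat.bit b n) 0)
  have h₂ := natSize_foldl_bit_le l.reverse 0
  rw [List.foldl_reverse, List.length_reverse, Nat.size_zero] at h₂
  have h₃ := hl.length_le
  rw [Nat.size_eq_bits_len] at h₃
  have h₈ := le_size_bin (f a)
  have h₉ := le_size_bin (g a)
  have h₁₀ := hp a
  have h₁₁ := hq a
  simp only [Polynomial.eval_add, Polynomial.eval_mul, Polynomial.eval_ofNat, Polynomial.eval_one]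
  omega

/-- A bound for the sum of the lengths of the binary expansions of a family of numbers. -/
theorem natSize_foldr_le {β : Type} (op : ℕ → ℕ → ℕ)
    (hop : ∀ m n, (op m n).size ≤ m.size + n.size + 1) (f : β → ℕ) (c B : ℕ) (l : List β)
    (hB : ∀ b ∈ l, (f b).size ≤ B) :
    (l.foldr (fun b n => op (f b) n) c).size ≤ c.size + l.length * (B + 1) := by
  induction l with
  | nil => simp
  | cons b l ih =>
    have h₁ := hop (f b) (l.foldr (fun b n => op (f b) n) c)
    have h₂ := ih fun b hb => hB b (by simp [hb])
    have h₃ := hB b (by simp)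
    simp only [List.foldr_cons, List.length_cons, Nat.add_mul]
    omega

/-- Folds of an operation that adds up the lengths of its arguments, such as `+` and `*`. -/
theorem foldr_op {l : α → List β} {f : α → β → ℕ} {op : ℕ → ℕ → ℕ}
    (hop : ∀ m n, (op m n).size ≤ m.size + n.size + 1)
    (hop' : ∀ {γ : Type} [Coded γ] {f g : γ → ℕ}, PTimeBin f → PTimeBin g →
      PTimeBin fun a => op (f a) (g a)) (c : ℕ) (hl : PTime l)
    (hf : PTimeBin fun p : α × β => f p.1 p.2) :
    PTimeBin fun a => (l a).foldr (fun b n => op (f a b) n) c := by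
  obtain ⟨q, hq⟩ := hl.size_le
  obtain ⟨r, hr⟩ := hf.size_le
  have key : ∀ a (l : List β), l.foldr (fun b s => Bin.mk (op (f a b) s.val)) ⟨c⟩ =
      ⟨l.foldr (fun b n => op (f a b) n) c⟩ := by
    intro a l
    induction l with
    | nil => rfl
    | cons b l ih => rw [List.foldr_cons, List.foldr_cons, ih]
  refine (PTime.foldr (f := fun a b s => Bin.mk (op (f a b) s.val)) hl (PTime.const ⟨c⟩)
    (hop' (hf.comp (PTime.fst.pair (PTime.fst.comp PTime.snd)))
      (val (PTime.snd.comp PTime.snd)))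
    (4 * ((c.size : Polynomial ℕ) + q * (r.comp (X + q + 1) + 1)) + 1)
    fun a l' hl' => ?_).of_eq fun a => key a _
  rw [key]
  refine (size_bin_le _).trans ?_
  have h₁ := natSize_foldr_le op hop (f a) c (r.eval (size a + q.eval (size a) + 1)) l'
    fun b hb => by
      have h₁ := le_size_bin (f a b)
      have h₂ : size (Bin.mk (f a b)) ≤ _ := hr (a, b)
      have h₃ := eval_mono r (m := size (a, b)) (n := size a + q.eval (size a) + 1) (by
        have := size_le_of_mem (hl'.mem hb)
        have := hq a
        rw [size_pair]
        omega)
      omega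
  have h₂ : l'.length ≤ q.eval (size a) := by
    have := hq a
    have := length_le_size (l a)
    have := hl'.length_le
    omega
  have h₃ := Nat.mul_le_mul_right (r.eval (size a + q.eval (size a) + 1) + 1) h₂
  simp only [Polynomial.eval_add, Polynomial.eval_mul, Polynomial.eval_ofNat,
    Polynomial.eval_one, Polynomial.eval_comp, Polynomial.eval_X, Polynomial.eval_natCast,
    Nat.cast_id]
  omega

theorem prod_map {l : α → List β} {f : α → β → ℕ} (hl : PTime l)
    (hf : PTimeBin fun p : α × β => f p.1 p.2) : PTimeBin fun a => ((l a).map (f a)).prod :=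
  (foldr_op (fun m n => (natSize_mul_le m n).trans (Nat.le_succ _)) mul 1 hl hf).of_eq
    fun a => by rw [List.prod_eq_foldr, List.foldr_map]

theorem sum_map {l : α → List β} {f : α → β → ℕ} (hl : PTime l)
    (hf : PTimeBin fun p : α × β => f p.1 p.2) : PTimeBin fun a => ((l a).map (f a)).sum :=
  (foldr_op natSize_add_le add 0 hl hf).of_eq
    fun a => by rw [List.sum_eq_foldr, List.foldr_map]

end PTimeBin

/-! ### From programs to the class P -/

/-- The labels of the machine that decides a language by running `p`: three labels of its own, for
initialization (`0`), for reading the input (`1`) and for the output (`2`), and those of `p`. -/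
abbrev MachineLabel (p : Prog) : Type := Fin 3 ⊕ Label p

/-- Push a string to `main`, the last bit first. -/
def pushAll {Λ : Type} : List Bool → TM2.Stmt Sym Λ (Option Bool) → TM2.Stmt Sym Λ (Option Bool)
  | [], k => k
  | x :: l, k => pushAll l (.push (.reg .main) (fun _ => x) k)

theorem stepAux_pushAll {Λ : Type} (l : List Bool) (k : TM2.Stmt Sym Λ (Option Bool))
    (v : Option Bool) (i : List Γ') (o R : List Bool) :
    Turing.TM2.stepAux (pushAll l k) v (stackContents i o (st R)) =
      Turing.TM2.stepAux k v (stackContents i o (st (l ++ R))) := by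
  induction l generalizing k with
  | nil => rfl
  | cons x l ih =>
    rw [pushAll, ih, Turing.TM2.stepAux]
    congr 1
    exact (stackContents_set i o (st (l ++ R)) .main _).symm

/-- Code that moves one input symbol, assumed to be in the given list, to the list on `main`, and
starts `p` if there is none left. As the internal state of the machine only holds a bit, the
symbol is identified by comparing it with all candidates. -/
def readCode (p : Prog) : List Γ' → TM2.Stmt Sym (MachineLabel p) (Option Bool)
  | [] => .goto fun _ => .inr (Label.entry p)
  | x :: xs => .peek .inp (fun _ o => some (decide (o = some x)))
      (.branch (fun v => decide (v = some true))
        (pushAll (true :: enc x) (.pop .inp (fun v _ => v) (.goto fun _ => .inl 1)))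
        (readCode p xs))

/-- The machine that decides a language by running `p`. -/
def machine (p : Prog) : MachineLabel p → TM2.Stmt Sym (MachineLabel p) (Option Bool)
  | .inl 0 => .push (.reg .main) (fun _ => false) (.goto fun _ => .inl 1)
  | .inl 1 => readCode p [.blank, .bit false, .bit true, .bra, .ket, .comma]
  | .inl 2 => .pop (.reg .main) (fun _ o => o) (.branch (fun v => decide (v = some true))
      (.pop (.reg .main) (fun v _ => v) (.pop (.reg .main) (fun v _ => v)
        (.push .out (fun _ => true) (.load (fun _ => none) .halt))))
      (.push .out (fun _ => false) (.load (fun _ => none) .halt)))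
  | .inr l => compile p .inr (.inl 2) l

theorem update_inp (i i' : List Γ') (o : List Bool) (s : Store) :
    Function.update (stackContents i o s) .inp i' = stackContents i' o s := by
  funext k
  rcases k with _ | _ | r
  · rw [Function.update_self]; rfl
  · rw [Function.update_of_ne (by decide)]; rfl
  · rw [Function.update_of_ne (by simp)]; rfl

theorem update_out (i : List Γ') (o o' : List Bool) (s : Store) :
    Function.update (stackContents i o s) .out o' = stackContents i o' s := by
  funext k
  rcases k with _ | _ | r
  · rw [Function.update_of_ne (by decide)]; rfl
  · rw [Function.update_self]; rfl
  · rw [Function.update_of_ne (by simp)]; rfl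

theorem stepAux_readCode_nil (p : Prog) (xs : List Γ') (v : Option Bool) (o R : List Bool) :
    ∃ v', Turing.TM2.stepAux (readCode p xs) v (stackContents [] o (st R)) =
      ⟨some (.inr (Label.entry p)), v', stackContents [] o (st R)⟩ := by
  induction xs generalizing v with
  | nil => exact ⟨v, rfl⟩
  | cons x xs ih =>
    obtain ⟨v', h⟩ := ih (some false)
    exact ⟨v', h⟩

theorem stepAux_readCode_cons (p : Prog) (x : Γ') (i : List Γ') (xs : List Γ') (hx : x ∈ xs)
    (v : Option Bool) (o R : List Bool) :
    ∃ v', Turing.TM2.stepAux (readCode p xs) v (stackContents (x :: i) o (st R)) =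
      ⟨some (.inl 1), v', stackContents i o (st (true :: enc x ++ R))⟩ := by
  induction xs generalizing v with
  | nil => simp at hx
  | cons y xs ih =>
    rw [readCode, Turing.TM2.stepAux, Turing.TM2.stepAux]
    by_cases h : x = y
    · subst h
      refine ⟨some true, ?_⟩
      rw [show (stackContents (x :: i) o (st R) .inp).head? = some x from rfl]
      simp only [decide_true, cond_true]
      rw [stepAux_pushAll, Turing.TM2.stepAux, Turing.TM2.stepAux]
      congr 1
      exact update_inp _ _ _ _
    · rw [show (stackContents (x :: i) o (st R) .inp).head? = some x from rfl]
      simp only [Option.some.injEq, h, decide_false, Bool.false_eq_true, cond_false]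
      exact ih (by simpa [h] using hx) _

theorem mem_symbols (x : Γ') :
    x ∈ [Γ'.blank, .bit false, .bit true, .bra, .ket, .comma] := by
  rcases x with _ | (_ | _) | _ | _ | _ <;> decide

theorem reach_read (p : Prog) (i : List Γ') (l : List Γ') (v : Option Bool) :
    ∃ v', Reach (machine p) (i.length + 1) ⟨some (.inl 1), v, stackContents i [] (st (enc l))⟩
      ⟨some (.inr (Label.entry p)), v', stackContents [] [] (st (enc (i.reverse ++ l)))⟩ := by
  induction i generalizing l v with
  | nil =>
    obtain ⟨v', h⟩ := stepAux_readCode_nil p [.blank, .bit false, .bit true, .bra, .ket, .comma] v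
      [] (enc l)
    refine ⟨v', Reach.single ?_⟩
    rw [Turing.TM2.step, machine, h]
    rfl
  | cons x i ih =>
    obtain ⟨v₁, h₁⟩ := stepAux_readCode_cons p x i _ (mem_symbols x) v [] (enc l)
    obtain ⟨v₂, h₂⟩ := ih (x :: l) v₁
    refine ⟨v₂, Reach.mono (n := 1 + (i.length + 1)) (Reach.trans
      (y := ⟨some (.inl 1), v₁, stackContents i [] (st (enc (x :: l)))⟩) (Reach.single ?_) ?_) ?_⟩
    · rw [Turing.TM2.step, machine, h₁]
      rfl
    · rw [List.reverse_cons, List.append_assoc]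
      exact h₂
    · simp only [List.length_cons]; omega

theorem step_output (p : Prog) (b : Bool) (v : Option Bool) :
    Turing.TM2.step (machine p) ⟨some (.inl 2), v, stackContents [] [] (st (enc b))⟩ =
      some ⟨none, none, stackContents [] [b] (st [])⟩ := by
  rw [Turing.TM2.step, machine]
  cases b
  · simp only [Turing.TM2.stepAux]
    rw [← stackContents_set]
    exact congrArg (fun s => some (TM2.Cfg.mk _ _ s)) (update_out _ _ _ _)
  · simp only [Turing.TM2.stepAux]
    rw [← stackContents_set, ← stackContents_set, ← stackContents_set]
    exact congrArg (fun s => some (TM2.Cfg.mk _ _ s)) (update_out _ _ _ _)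

/-- A language is in P if its characteristic function is computable by a program in polynomial
time. -/
theorem inP_of_pTime (L : Language Γ') (f : List Γ' → Bool) (hf : PTime f)
    (h : ∀ w, f w = true ↔ w ∈ L) : InP L := by
  classical
  obtain ⟨p, q, hp⟩ := hf.comp (PTime.reverse PTime.id)
  refine ⟨{
    tm := {
      K := Stk
      k₀ := .inp
      k₁ := .out
      Γ := Sym
      Λ := MachineLabel p
      main := .inl 0
      σ := Option Bool
      initialState := none
      Γk₀Fin := inferInstanceAs (Fintype Γ')
      m := machine p }
    inputAlphabet := Equiv.refl _
    outputAlphabet := Equiv.refl _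
    time := X + 3 + q.comp (12 * X + 1)
    outputsFun := fun w => Classical.choice ?_ }⟩
  have e₀ : w.reverse.reverse = w := List.reverse_reverse w
  have h₁ : Reach (machine p) 1 ⟨some (.inl 0), none, stackContents w [] (st [])⟩
      ⟨some (.inl 1), none, stackContents w [] (st (enc ([] : List Γ')))⟩ := by
    refine Reach.single ?_
    rw [Turing.TM2.step, machine, Turing.TM2.stepAux, Turing.TM2.stepAux]
    exact congrArg (fun s => some (TM2.Cfg.mk _ _ s)) (stackContents_set w [] (st []) .main _).symm
  obtain ⟨v₂, h₂⟩ := reach_read p w [] none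
  rw [List.append_nil] at h₂
  have hx := (hp w.reverse).2 []
  rw [List.append_nil, List.append_nil] at hx
  obtain ⟨v₃, h₃⟩ := hx.reach (M := machine p) (i := []) (o := []) .inr (.inl 2)
    (fun _ => rfl) v₂
  simp only [e₀] at h₃
  have h₄ := Reach.single (step_output p (f w) v₃)
  obtain ⟨k, hk, e⟩ := ((h₁.trans h₂).trans h₃).trans h₄
  have hfw : f w = decide (w ∈ L) := by
    rw [Bool.eq_iff_iff, h, decide_eq_true_iff]
  refine ⟨⟨k, ?_⟩, hk.trans ?_⟩
  · have hw : List.map (Equiv.refl Γ').invFun (id w) = w := List.map_id w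
    have hb : Computability.encodeBool (decide (w ∈ L)) = [f w] := by rw [hfw]; rfl
    refine Eq.trans (congrArg _ (congrArg some ?_)) (e.trans (congrArg some ?_))
    · refine congrArg (TM2.Cfg.mk _ _) (funext fun k => ?_)
      rcases k with _ | _ | r
      · exact hw
      · rfl
      · cases r <;> rfl
    · refine congrArg (TM2.Cfg.mk _ _) (funext fun k => ?_)
      rcases k with _ | _ | r
      · rfl
      · rw [hb]; rfl
      · cases r <;> rfl
  · have hs : size w.reverse ≤ 12 * w.length + 1 := by
      have := size_list_le (l := w.reverse) (B := 11) fun x _ => by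
        rcases x with _ | (_ | _) | _ | _ | _ <;> decide
      rw [List.length_reverse] at this
      omega
    have := eval_mono q hs
    simp only [id_eq, Polynomial.eval_add, Polynomial.eval_X, Polynomial.eval_ofNat,
      Polynomial.eval_comp, Polynomial.eval_mul, Polynomial.eval_one]
    omega

/-! ### The posterior probability of a top alternative -/

/-- The unordered pairs of distinct alternatives. -/
abbrev Pairs (m : ℕ) : Type := {x : Fin m × Fin m // x.1 < x.2}

open Classical in
/-- A tournament is an independent choice of a winner for each pair of alternatives. -/
noncomputable def tournamentEquiv (m : ℕ) : Tournament m ≃ (Pairs m → Bool) where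
  toFun W x := decide (W.1 x.1.1 x.1.2)
  invFun f := ⟨fun a b => (∃ h : a < b, f ⟨(a, b), h⟩ = true) ∨ ∃ h : b < a, f ⟨(b, a), h⟩ = false,
    by
      refine ⟨?_, ?_, ?_⟩
      · rintro a (⟨h, -⟩ | ⟨h, -⟩) <;> exact lt_irrefl _ h
      · rintro a b (⟨h, e⟩ | ⟨h, e⟩) (⟨h', e'⟩ | ⟨h', e'⟩)
        · exact absurd h' (lt_asymm h)
        · rw [e] at e'; cases e'
        · rw [e] at e'; cases e'
        · exact absurd h' (lt_asymm h)
      · intro a b hab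
        rcases lt_or_gt_of_ne hab with h | h
        · cases e : f ⟨(a, b), h⟩
          · exact .inr (.inr ⟨h, e⟩)
          · exact .inl (.inl ⟨h, e⟩)
        · cases e : f ⟨(b, a), h⟩
          · exact .inl (.inr ⟨h, e⟩)
          · exact .inr (.inl ⟨h, e⟩)⟩
  left_inv W := by
    obtain ⟨r, h₁, h₂, h₃⟩ := W
    refine Subtype.ext (funext fun a => funext fun b => propext ?_)
    simp only [decide_eq_true_eq, decide_eq_false_iff_not, exists_prop]
    constructor
    · rintro (⟨-, h⟩ | ⟨h, h'⟩)
      · exact h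
      · exact (h₃ a b (ne_of_gt h)).resolve_right h'
    · intro h
      have hab : a ≠ b := by rintro rfl; exact h₁ a h
      rcases lt_or_gt_of_ne hab with h' | h'
      · exact .inl ⟨h', h⟩
      · exact .inr ⟨h', fun h'' => hab (h₂ a b h h'')⟩
  right_inv f := by
    funext ⟨⟨a, b⟩, h⟩
    have h : a < b := h
    simp only [h, exists_true_left, not_lt_of_gt h, IsEmpty.exists_iff, or_false,
      Bool.decide_eq_true]

open Classical in
/-- A sum over all tournaments of a product over the pairs factorizes. -/
theorem sum_prod_tournament {m : ℕ} (g : Pairs m → Bool → ℝ) :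
    ∑ W : Tournament m, ∏ x : Pairs m, g x (decide (W.1 x.1.1 x.1.2)) =
      ∏ x : Pairs m, (g x true + g x false) := by
  have h := Finset.prod_univ_sum (fun _ : Pairs m => (Finset.univ : Finset Bool)) g
  simp only [Fintype.univ_bool, Finset.mem_singleton, Bool.true_eq_false, not_false_eq_true,
    Finset.sum_insert, Finset.sum_singleton] at h
  rw [h, ← Fintype.univ_bool, Fintype.piFinset_univ]
  exact Fintype.sum_equiv (tournamentEquiv m) _ _ fun W => rfl

open Classical in
theorem pow_kendall {m : ℕ} (φ : ℝ) (V W : Tournament m) :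
    φ ^ kendall V W =
      ∏ x : Pairs m, if V.1 x.1.1 x.1.2 ↔ W.1 x.1.1 x.1.2 then 1 else φ := by
  rw [← Finset.prod_subtype (Finset.univ.filter fun p : Fin m × Fin m => p.1 < p.2)
    (fun x => by simp) (fun x => if V.1 x.1 x.2 ↔ W.1 x.1 x.2 then 1 else φ),
    Finset.prod_ite, Finset.prod_const_one, one_mul, Finset.prod_const, Finset.filter_filter]
  rfl

/-- The normalization constant of the Condorcet model does not depend on the parameter. -/
theorem sum_pow_kendall {m : ℕ} (φ : ℝ) (W : Tournament m) :
    ∑ U : Tournament m, φ ^ kendall U W = (1 + φ) ^ Fintype.card (Pairs m) := by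
  classical
  have h := sum_prod_tournament fun (x : Pairs m) (b : Bool) =>
    if b = true ↔ W.1 x.1.1 x.1.2 then 1 else φ
  simp only [decide_eq_true_eq] at h
  simp only [pow_kendall, h]
  rw [← Finset.card_univ, ← Finset.prod_const]
  refine Finset.prod_congr rfl fun x _ => ?_
  by_cases hx : W.1 x.1.1 x.1.2 <;> simp [hx, add_comm]

/-- The likelihood of the votes on the pair `a`, `b` if `a` beats `b`, up to a constant that does not
depend on the two alternatives. -/
def beatLikelihood {m : ℕ} (φ : ℝ) (P : Profile m) (a b : Fin m) : ℝ :=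
  (P.map fun V => if V.symm a ≤ V.symm b then 1 else φ).prod

open Classical in
theorem likelihood_eq {m : ℕ} (φ : ℝ) (P : Profile m) (W : Tournament m) :
    likelihood (condorcetPr φ) P W = (1 / (1 + φ) ^ Fintype.card (Pairs m)) ^ P.length *
      ∏ x : Pairs m, if decide (W.1 x.1.1 x.1.2) then beatLikelihood φ P x.1.1 x.1.2
        else beatLikelihood φ P x.1.2 x.1.1 := by
  induction P with
  | nil => simp [likelihood, beatLikelihood]
  | cons V P ih =>
    have hx : ∀ x : Pairs m, (if decide (W.1 x.1.1 x.1.2) then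
        beatLikelihood φ (V :: P) x.1.1 x.1.2 else beatLikelihood φ (V :: P) x.1.2 x.1.1) =
        (if V.toTournament.1 x.1.1 x.1.2 ↔ W.1 x.1.1 x.1.2 then 1 else φ) *
        if decide (W.1 x.1.1 x.1.2) then beatLikelihood φ P x.1.1 x.1.2
          else beatLikelihood φ P x.1.2 x.1.1 := by
      rintro ⟨⟨a, b⟩, hab⟩
      have hne : V.symm a ≠ V.symm b := fun e => ne_of_lt hab (V.symm.injective e)
      have hV : V.toTournament.1 a b ↔ V.symm a ≤ V.symm b := (lt_iff_le_and_ne.trans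
        (and_iff_left hne))
      have hV' : ¬ V.symm a ≤ V.symm b ↔ V.symm b ≤ V.symm a :=
        not_le.trans (lt_iff_le_and_ne.trans (and_iff_left hne.symm))
      simp only [beatLikelihood, List.map_cons, List.prod_cons, hV, decide_eq_true_eq]
      by_cases h₁ : W.1 a b <;> by_cases h₂ : V.symm a ≤ V.symm b <;>
        simp [h₁, h₂, ← hV']
    rw [Finset.prod_congr rfl fun x _ => hx x, Finset.prod_mul_distrib, ← pow_kendall]
    unfold likelihood at ih ⊢
    rw [List.map_cons, List.prod_cons, ih, condorcetPr, sum_pow_kendall, List.length_cons, pow_succ]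
    ring

/-- The contribution of a pair of alternatives to the event that `c` is the top alternative. -/
def topFactor {m : ℕ} (φ : ℝ) (P : Profile m) (c : Fin m) (x : Pairs m) : ℝ :=
  if x.1.1 = c then beatLikelihood φ P c x.1.2
  else if x.1.2 = c then beatLikelihood φ P c x.1.1
  else beatLikelihood φ P x.1.1 x.1.2 + beatLikelihood φ P x.1.2 x.1.1

open Classical in
theorem one_sub_topLoss {m : ℕ} (W : Tournament m) (c : Fin m) :
    1 - topLoss W c = ∏ x : Pairs m, if x.1.1 = c ∧ decide (W.1 x.1.1 x.1.2) = false ∨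
      x.1.2 = c ∧ decide (W.1 x.1.1 x.1.2) = true then 0 else 1 := by
  unfold topLoss
  split
  · rename_i h
    rw [sub_zero, Finset.prod_eq_one]
    rintro ⟨⟨a, b⟩, hab⟩ -
    rw [if_neg]
    have hab : a < b := hab
    rintro (⟨rfl, h'⟩ | ⟨rfl, h'⟩)
    · exact (decide_eq_false_iff_not.1 h') (h b (ne_of_gt hab))
    · exact ne_of_lt hab (W.2.2.1 a b (of_decide_eq_true h') (h a (ne_of_lt hab)))
  · rename_i h
    push Not at h
    obtain ⟨b, hb, hW⟩ := h
    rw [sub_self, eq_comm, Finset.prod_eq_zero_iff]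
    rcases lt_or_gt_of_ne hb with hlt | hlt
    · refine ⟨⟨(b, c), hlt⟩, Finset.mem_univ _, if_pos (.inr ⟨rfl, decide_eq_true ?_⟩)⟩
      exact (W.2.2.2 b c hb).resolve_right hW
    · exact ⟨⟨(c, b), hlt⟩, Finset.mem_univ _, if_pos (.inl ⟨rfl, decide_eq_false hW⟩)⟩

/-- The unnormalized posterior probability that `c` is the top alternative. -/
theorem sum_likelihood_top {m : ℕ} (φ : ℝ) (P : Profile m) (c : Fin m) :
    ∑ W : Tournament m, likelihood (condorcetPr φ) P W * (1 - topLoss W c) =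
      (1 / (1 + φ) ^ Fintype.card (Pairs m)) ^ P.length * ∏ x : Pairs m, topFactor φ P c x := by
  classical
  simp only [likelihood_eq, one_sub_topLoss, mul_assoc, ← Finset.prod_mul_distrib]
  rw [← Finset.mul_sum, sum_prod_tournament fun (x : Pairs m) (b : Bool) =>
    (if b then beatLikelihood φ P x.1.1 x.1.2 else beatLikelihood φ P x.1.2 x.1.1) *
      if x.1.1 = c ∧ b = false ∨ x.1.2 = c ∧ b = true then 0 else 1]
  congr 1
  refine Finset.prod_congr rfl fun ⟨⟨a, b⟩, hab⟩ _ => ?_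
  have hne : a ≠ b := ne_of_lt hab
  simp only [topFactor]
  by_cases ha : a = c
  · have hb : b ≠ c := fun e => hne (ha.trans e.symm)
    subst ha
    simp [hb]
  · by_cases hb : b = c
    · subst hb
      simp [ha]
    · simp [ha, hb]

/-! ### Scores -/

/-- `beatLikelihood` for the dispersion `p / q`, multiplied by `q ^ P.length`. -/
def beatWeight {m : ℕ} (p q : ℕ) (P : Profile m) (a b : Fin m) : ℕ :=
  (P.map fun V => if V.symm a ≤ V.symm b then q else p).prod

/-- A number that is proportional to the posterior probability that `c` is the top alternative,
for the dispersion `p / q`. Every pair of distinct alternatives occurs twice in the product, and the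
diagonal is included; both only contribute a factor that does not depend on `c`. -/
def score {m : ℕ} (p q : ℕ) (P : Profile m) (c : Fin m) : ℕ :=
  ∏ a, ∏ b, if a = c then beatWeight p q P a b else beatWeight p q P a b + beatWeight p q P b a

theorem beatWeight_eq {m : ℕ} {p q : ℕ} (hq : q ≠ 0) (P : Profile m) (a b : Fin m) :
    (beatWeight p q P a b : ℝ) = (q : ℝ) ^ P.length * beatLikelihood (p / q : ℝ) P a b := by
  have hq' : (q : ℝ) ≠ 0 := by exact_mod_cast hq
  unfold beatWeight beatLikelihood
  induction P with
  | nil => simp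
  | cons V P ih =>
    simp only [List.map_cons, List.prod_cons, Nat.cast_mul, ih, List.length_cons, pow_succ]
    split
    · ring
    · field_simp

theorem beatLikelihood_pos {m : ℕ} {φ : ℝ} (hφ : 0 < φ) (P : Profile m) (a b : Fin m) :
    0 < beatLikelihood φ P a b := by
  unfold beatLikelihood
  refine List.prod_pos fun x hx => ?_
  obtain ⟨V, -, rfl⟩ := List.mem_map.1 hx
  split
  · exact one_pos
  · exact hφ

theorem prod_prod_eq_pairs {m : ℕ} (G : Fin m → Fin m → ℝ) :
    ∏ a, ∏ b, G a b = (∏ a, G a a) * ∏ x : Pairs m, (G x.1.1 x.1.2 * G x.1.2 x.1.1) := by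
  classical
  have h₁ : ∏ x : Pairs m, (G x.1.1 x.1.2 * G x.1.2 x.1.1) =
      (∏ x ∈ Finset.univ.filter (fun p : Fin m × Fin m => p.1 < p.2), G x.1 x.2) *
      ∏ x ∈ Finset.univ.filter (fun p : Fin m × Fin m => p.2 < p.1), G x.1 x.2 := by
    rw [← Finset.prod_subtype (Finset.univ.filter fun p : Fin m × Fin m => p.1 < p.2)
      (fun x => by simp) (fun x => G x.1 x.2 * G x.2 x.1), Finset.prod_mul_distrib]
    congr 1
    exact Finset.prod_nbij' Prod.swap Prod.swap (by simp) (by simp) (by simp) (by simp) (by simp)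
  have h₂ : ∏ a, G a a =
      ∏ x ∈ Finset.univ.filter (fun p : Fin m × Fin m => p.1 = p.2), G x.1 x.2 := by
    refine Finset.prod_nbij' (fun a => (a, a)) Prod.fst (by simp) (by simp) (by simp) ?_ (by simp)
    rintro ⟨a, b⟩ h
    simpa using h
  rw [h₁, h₂, ← Fintype.prod_prod_type',
    ← Finset.prod_filter_mul_prod_filter_not _ (fun p : Fin m × Fin m => p.1 = p.2)]
  congr 1
  rw [← Finset.prod_filter_mul_prod_filter_not _ (fun p : Fin m × Fin m => p.1 < p.2),
    Finset.filter_filter, Finset.filter_filter]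
  congr 1
  · refine Finset.prod_congr (Finset.filter_congr fun x _ => ?_) fun _ _ => rfl
    exact and_iff_right_of_imp fun h => ne_of_lt h
  · refine Finset.prod_congr (Finset.filter_congr fun x _ => ?_) fun _ _ => rfl
    omega

theorem score_eq {m : ℕ} {p q : ℕ} (hp : p ≠ 0) (hq : q ≠ 0) (P : Profile m) :
    ∃ κ : ℝ, 0 < κ ∧ ∀ c, ∏ x : Pairs m, topFactor (p / q : ℝ) P c x = κ * score p q P c := by
  classical
  have hφ : 0 < (p / q : ℝ) := by positivity
  set φ : ℝ := p / q
  set u : ℝ := (q : ℝ) ^ P.length with hu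
  have hu_pos : 0 < u := by positivity
  have hself : ∀ a, beatLikelihood φ P a a = 1 := fun a => by simp [beatLikelihood]
  refine ⟨(u * (2 * u) ^ (m - 1) * ∏ x : Pairs m, (u * (u * (beatLikelihood φ P x.1.1 x.1.2 +
    beatLikelihood φ P x.1.2 x.1.1))))⁻¹, ?_, fun c => ?_⟩
  · refine inv_pos.2 (mul_pos (by positivity) (Finset.prod_pos fun x _ => ?_))
    have := beatLikelihood_pos hφ P x.1.1 x.1.2
    have := beatLikelihood_pos hφ P x.1.2 x.1.1
    positivity
  · rw [eq_inv_mul_iff_mul_eq₀]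
    · unfold score
      simp only [Nat.cast_prod]
      rw [prod_prod_eq_pairs fun a b => (((if a = c then beatWeight p q P a b
        else beatWeight p q P a b + beatWeight p q P b a : ℕ)) : ℝ), mul_assoc,
        ← Finset.prod_mul_distrib]
      congr 1
      · rw [Fintype.prod_eq_mul_prod_compl c]
        rw [if_pos rfl, beatWeight_eq hq, hself, mul_one]
        congr 1
        rw [Finset.prod_congr rfl (g := fun _ => 2 * u), Finset.prod_const, Finset.card_compl,
          Fintype.card_fin, Finset.card_singleton]
        intro a ha
        rw [if_neg (by simpa using ha), Nat.cast_add, beatWeight_eq hq, hself]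
        ring
      · refine Finset.prod_congr rfl fun ⟨⟨a, b⟩, hab⟩ _ => ?_
        have hne : a ≠ b := ne_of_lt hab
        simp only [topFactor]
        by_cases ha : a = c
        · have hb : b ≠ c := fun e => hne (ha.trans e.symm)
          subst ha
          simp only [if_true, hb, if_false, Nat.cast_add, beatWeight_eq hq]
          ring
        · by_cases hb : b = c
          · subst hb
            simp only [if_true, ha, if_false, Nat.cast_add, beatWeight_eq hq]
            ring
          · simp only [ha, hb, if_false, Nat.cast_add, beatWeight_eq hq]
            ring
    · refine ne_of_gt (mul_pos (by positivity) (Finset.prod_pos fun x _ => ?_))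
      have := beatLikelihood_pos hφ P x.1.1 x.1.2
      have := beatLikelihood_pos hφ P x.1.2 x.1.1
      positivity

theorem topLossSet_eq {m : ℕ} (W : Tournament m) (d : Decision m) :
    topLossSet W d = 1 - (∑ c ∈ d.1, (1 - topLoss W c)) / (d.1.card : ℝ) := by
  have hd : (d.1.card : ℝ) ≠ 0 := by exact_mod_cast d.2.card_ne_zero
  unfold topLossSet
  rw [Finset.sum_sub_distrib, Finset.sum_const, nsmul_eq_mul, mul_one]
  field_simp
  ring

instance (m : ℕ) : Nonempty (Tournament m) := ⟨Vote.toTournament (Equiv.refl _)⟩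

/-- The risk of a decision is a decreasing affine function of the average score of its members. -/
theorem condorcetRisk_eq {m : ℕ} {p q : ℕ} (hp : p ≠ 0) (hq : q ≠ 0) (P : Profile m) :
    ∃ κ : ℝ, 0 < κ ∧ ∀ d : Decision m, condorcetRisk (p / q : ℝ) P d =
      1 - κ * ((∑ c ∈ d.1, score p q P c : ℕ) / (d.1.card : ℝ)) := by
  classical
  have hφ : 0 < (p / q : ℝ) := by positivity
  obtain ⟨κ, hκ, hscore⟩ := score_eq hp hq P
  set φ : ℝ := p / q
  have hL : ∀ W : Tournament m, 0 < likelihood (condorcetPr φ) P W := fun W => by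
    rw [likelihood_eq]
    refine mul_pos (by positivity) (Finset.prod_pos fun x _ => ?_)
    split <;> exact beatLikelihood_pos hφ _ _ _
  set S := ∑ W : Tournament m, likelihood (condorcetPr φ) P W with hS
  have hS_pos : 0 < S := Finset.sum_pos (fun W _ => hL W) Finset.univ_nonempty
  have hcard : 0 < (1 / (Fintype.card (Tournament m) : ℝ)) := by
    have : 0 < Fintype.card (Tournament m) := Fintype.card_pos
    positivity
  have hpost : ∀ W, posterior (uniformPrior (Tournament m)) (condorcetPr φ) P W =
      likelihood (condorcetPr φ) P W / S := fun W => by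
    unfold posterior uniformPrior
    rw [← Finset.sum_mul, mul_div_mul_right _ _ hcard.ne']
  refine ⟨(1 / (1 + φ) ^ Fintype.card (Pairs m)) ^ P.length * κ / S, by positivity, fun d => ?_⟩
  unfold condorcetRisk bayesRisk
  simp only [hpost, topLossSet_eq, mul_sub, mul_one, Finset.sum_sub_distrib]
  rw [← Finset.sum_div, ← hS, div_self hS_pos.ne']
  congr 1
  have h : ∀ c, ∑ W : Tournament m, likelihood (condorcetPr φ) P W * (1 - topLoss W c) =
      (1 / (1 + φ) ^ Fintype.card (Pairs m)) ^ P.length * (κ * score p q P c) := fun c => by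
    rw [sum_likelihood_top, hscore]
  calc _ = (∑ c ∈ d.1, ∑ W : Tournament m,
        likelihood (condorcetPr φ) P W * (1 - topLoss W c)) / (S * d.1.card) := by
        rw [Finset.sum_comm, Finset.sum_div]
        refine Finset.sum_congr rfl fun W _ => ?_
        rw [← Finset.mul_sum, div_mul_div_comm]
        simp only [Finset.sum_sub_distrib]
    _ = _ := by
        simp only [h]
        rw [← Finset.mul_sum, ← Finset.mul_sum]
        push_cast
        field_simp

/-- The comparison of two risks, in terms of the sums of the scores. -/
theorem condorcetRisk_le_iff {m : ℕ} {p q : ℕ} (hp : p ≠ 0) (hq : q ≠ 0) (P : Profile m)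
    (d₁ d₂ : Decision m) : condorcetRisk (p / q : ℝ) P d₁ ≤ condorcetRisk (p / q : ℝ) P d₂ ↔
      d₁.1.card * ∑ c ∈ d₂.1, score p q P c ≤ d₂.1.card * ∑ c ∈ d₁.1, score p q P c := by
  obtain ⟨κ, hκ, h⟩ := condorcetRisk_eq hp hq P
  have h₁ : (0 : ℝ) < d₁.1.card := by exact_mod_cast d₁.2.card_pos
  have h₂ : (0 : ℝ) < d₂.1.card := by exact_mod_cast d₂.2.card_pos
  rw [h, h, sub_le_sub_iff_left, mul_le_mul_iff_right₀ hκ, div_le_div_iff₀ h₂ h₁]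
  rw [mul_comm, mul_comm _ (d₂.1.card : ℝ)]
  exact_mod_cast Iff.rfl

/-- A decision is optimal if and only if all its members have maximal score. -/
theorem condorcetRisk_optimal_iff {m : ℕ} {p q : ℕ} (hp : p ≠ 0) (hq : q ≠ 0) (P : Profile m)
    (d : Decision m) :
    (∀ d', condorcetRisk (p / q : ℝ) P d ≤ condorcetRisk (p / q : ℝ) P d') ↔
      ∀ c ∈ d.1, ∀ b, score p q P b ≤ score p q P c := by
  simp only [condorcetRisk_le_iff hp hq]
  constructor
  · intro h c hc b
    -- it suffices to compare with a singleton of maximal score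
    obtain ⟨b₀, -, hb₀⟩ := Finset.exists_max_image Finset.univ (score p q P)
      ⟨c, Finset.mem_univ c⟩
    have h₀ := h ⟨{b₀}, Finset.singleton_nonempty _⟩
    simp only [Finset.sum_singleton, Finset.card_singleton, one_mul] at h₀
    rw [← smul_eq_mul, ← Finset.sum_const] at h₀
    have hle : ∀ x ∈ d.1, score p q P x ≤ score p q P b₀ := fun x _ => hb₀ x (Finset.mem_univ x)
    have heq := (Finset.sum_eq_sum_iff_of_le hle).1 (le_antisymm (Finset.sum_le_sum hle) h₀)
    rw [heq c hc]
    exact hb₀ b (Finset.mem_univ b)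
  · intro h d'
    have hle : ∀ b ∈ d'.1, d.1.card * score p q P b ≤ ∑ c ∈ d.1, score p q P c := fun b _ => by
      rw [← smul_eq_mul, ← Finset.sum_const]
      exact Finset.sum_le_sum fun c hc => h c hc b
    rw [Finset.mul_sum]
    exact (Finset.sum_le_sum hle).trans_eq (by rw [Finset.sum_const, smul_eq_mul])

/-! ### The decision procedures -/

/-- Whether `a` occurs in the list, and `b` not before it. -/
def before (a b : ℕ) (V : List ℕ) : Bool :=
  V.foldr (fun x r => if decide (x = a) then true else if decide (x = b) then false else r) false

/-- The counterpart of `beatWeight` for votes given as lists of numbers. -/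
def listBeatWeight (p q : ℕ) (P : List (List ℕ)) (a b : ℕ) : ℕ :=
  (P.map fun V => if before a b V then q else p).prod

/-- The counterpart of `score` for votes given as lists of numbers. -/
def listScore (p q m : ℕ) (P : List (List ℕ)) (c : ℕ) : ℕ :=
  ((List.range m).map fun a => ((List.range m).map fun b =>
    if decide (a = c) then listBeatWeight p q P a b
    else listBeatWeight p q P a b + listBeatWeight p q P b a).prod).prod

/-- The sum of the scores of the members of a set given by its membership bits. -/
def listScoreSum (p q : ℕ) (d : List Bool) (P : List (List ℕ)) : ℕ :=
  ((List.range d.length).map fun c =>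
    if d.getD c false then listScore p q d.length P c else 0).sum

/-- The number of members of a set given by its membership bits. -/
def listCard (d : List Bool) : ℕ :=
  ((List.range d.length).map fun c => if d.getD c false then 1 else 0).sum

/-- Whether a list of numbers is a ranking of the alternatives `0, …, m - 1`. -/
def isVote (m : ℕ) (V : List ℕ) : Bool :=
  decide (V.length = m) && (List.range m).all fun a => V.any fun x => decide (x = a)

/-- The pieces of a string that are terminated by the symbol `k`; a piece at the end of the string
need not be terminated. -/
def pieces (k : Γ') (w : List Γ') : List (List Γ') :=
  w.foldr (fun x r => if decide (x = k) then [] :: r else match r with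
    | [] => [[x]]
    | s :: t => (x :: s) :: t) []

/-- Read a piece of the input as membership bits. -/
def readBits (s : List Γ') : List Bool := s.map fun x => decide (x = .bit true)

/-- Read a piece of the input as a vote. -/
def readVote (s : List Γ') : List ℕ := (pieces .comma s).map List.length

/-- The code of a list of membership bits. -/
def writeBits (d : List Bool) : List Γ' :=
  d.map (fun b => if b then Γ'.bit true else Γ'.bit false) ++ [.ket]

/-- The code of a list of votes. -/
def writeProfile (P : List (List ℕ)) : List Γ' :=
  P.flatMap fun V => (V.flatMap fun a => List.replicate a (Γ'.bit true) ++ [.comma]) ++ [.ket]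

/-- Whether membership bits and votes describe a decision and a profile. -/
def isInstance (d : List Bool) (P : List (List ℕ)) : Bool :=
  d.any (fun b => b) && P.all fun V => isVote d.length V

/-- Decides the better-Bayesian-decision problem on data read from the input `w`. The syntax is
checked by writing the data again and comparing with the input. -/
def betterCheck (p q : ℕ) (w : List Γ') (d₁ d₂ : List Bool) (P : List (List ℕ)) : Bool :=
  decide (writeBits d₁ ++ writeBits d₂ ++ writeProfile P = w) &&
    (isInstance d₁ P && (isInstance d₂ P && (decide (d₁.length = d₂.length) &&
      decide (listCard d₁ * listScoreSum p q d₂ P ≤ listCard d₂ * listScoreSum p q d₁ P))))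

/-- Decides the better-Bayesian-decision problem. -/
def betterDec (p q : ℕ) (w : List Γ') : Bool :=
  betterCheck p q w (readBits ((pieces .ket w).headD [])) (readBits ((pieces .ket w).tail.headD []))
    ((pieces .ket w).tail.tail.map readVote)

/-- Decides the optimal-Bayesian-decision problem on data read from the input `w`. -/
def optimalCheck (p q : ℕ) (w : List Γ') (d : List Bool) (P : List (List ℕ)) : Bool :=
  decide (writeBits d ++ writeProfile P = w) && (isInstance d P &&
    (List.range d.length).all fun c => !d.getD c false || (List.range d.length).all fun b =>
      decide (listScore p q d.length P b ≤ listScore p q d.length P c))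

/-- Decides the optimal-Bayesian-decision problem. -/
def optimalDec (p q : ℕ) (w : List Γ') : Bool :=
  optimalCheck p q w (readBits ((pieces .ket w).headD [])) ((pieces .ket w).tail.map readVote)

/-! ### Running time of the decision procedures -/

section PTime

variable {α : Type} [Coded α]

open PTime (fst snd id)

theorem pTime_before {a b : α → ℕ} {V : α → List ℕ} (ha : PTime a) (hb : PTime b)
    (hV : PTime V) : PTime fun x => before (a x) (b x) (V x) := by
  have hy : PTime fun p : α × ℕ × Bool => p.2.1 := fst.comp snd
  exact PTime.foldr (f := fun x y r =>
      if decide (y = a x) then true else if decide (y = b x) then false else r)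
    hV (.const false)
    ((hy.eq (ha.comp fst)).cond (.const true) ((hy.eq (hb.comp fst)).cond (.const false)
      (snd.comp snd)))
    3 fun _ _ _ => (size_bool_le _).trans (by simp)

variable (p q : ℕ)

theorem pTime_listBeatWeight {P : α → List (List ℕ)} {a b : α → ℕ} (hP : PTime P) (ha : PTime a)
    (hb : PTime b) : PTimeBin fun x => listBeatWeight p q (P x) (a x) (b x) :=
  PTimeBin.prod_map (f := fun x V => if before (a x) (b x) V then q else p) hP
    (.cond (pTime_before (ha.comp fst) (hb.comp fst) snd) (.const q) (.const p))

theorem pTime_listScore {m : α → ℕ} {P : α → List (List ℕ)} {c : α → ℕ} (hm : PTime m)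
    (hP : PTime P) (hc : PTime c) : PTimeBin fun x => listScore p q (m x) (P x) (c x) := by
  have hP' : PTime fun z : (α × ℕ) × ℕ => P z.1.1 := hP.comp (fst.comp fst)
  have ha : PTime fun z : (α × ℕ) × ℕ => z.1.2 := snd.comp fst
  have hb : PTime fun z : (α × ℕ) × ℕ => z.2 := snd
  exact .prod_map hm.range (.prod_map
    (f := fun (z : α × ℕ) b => if decide (z.2 = c z.1) then listBeatWeight p q (P z.1) z.2 b
      else listBeatWeight p q (P z.1) z.2 b + listBeatWeight p q (P z.1) b z.2)
    (hm.comp fst).range (.cond (ha.eq (hc.comp (fst.comp fst)))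
      (pTime_listBeatWeight p q hP' ha hb)
      ((pTime_listBeatWeight p q hP' ha hb).add (pTime_listBeatWeight p q hP' hb ha))))

theorem pTime_listScoreSum {d : α → List Bool} {P : α → List (List ℕ)} (hd : PTime d)
    (hP : PTime P) : PTimeBin fun x => listScoreSum p q (d x) (P x) :=
  .sum_map hd.length.range (.cond ((hd.comp fst).getD snd (.const false))
    (pTime_listScore p q (hd.comp fst).length (hP.comp fst) snd) (.const 0))

theorem pTime_listCard {d : α → List Bool} (hd : PTime d) : PTimeBin fun x => listCard (d x) :=
  .sum_map hd.length.range (.cond ((hd.comp fst).getD snd (.const false)) (.const 1) (.const 0))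

theorem pTime_isVote {m : α → ℕ} {V : α → List ℕ} (hm : PTime m) (hV : PTime V) :
    PTime fun x => isVote (m x) (V x) :=
  (hV.length.eq hm).and (.all hm.range (.any (f := fun (z : α × ℕ) y => decide (y = z.2))
    (hV.comp fst) (snd.eq (snd.comp fst))))

theorem pTime_pieces {w : α → List Γ'} (k : Γ') (hw : PTime w) :
    PTime fun x => pieces k (w x) := by
  have hy : PTime fun z : α × Γ' × List (List Γ') => z.2.1 := fst.comp snd
  have hr : PTime fun z : α × Γ' × List (List Γ') => z.2.2 := snd.comp snd
  refine PTime.foldr_of_add (f := fun _ y r => if decide (y = k) then [] :: r else match r with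
    | [] => [[y]]
    | s :: t => (y :: s) :: t) hw (.const [])
    ((hy.eq (.const k)).cond (.cons (.const []) hr)
      ((PTime.listCases (f := fun z : List Γ' × List (List Γ') × (α × Γ' × List (List Γ')) =>
        (z.2.2.2.1 :: z.1) :: z.2.1) hr (.cons (.cons hy (.const [])) (.const []))
        (.cons (.cons (fst.comp (snd.comp (snd.comp snd))) fst) (fst.comp snd))).of_eq
          fun z => by cases z.2.2 <;> rfl)) 20 ?_
  intro _ y _ r
  have hsize : size y ≤ 11 := by
    rcases y with _ | (_ | _) | _ | _ | _ <;> decide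
  rw [Polynomial.eval_ofNat]
  cases decide (y = k) <;> cases r <;> simp <;> omega

theorem pTime_readBits {s : α → List Γ'} (hs : PTime s) : PTime fun x => readBits (s x) :=
  hs.map (f := fun _ y => decide (y = Γ'.bit true)) (snd.eq (.const _))

theorem pTime_readVote {s : α → List Γ'} (hs : PTime s) : PTime fun x => readVote (s x) :=
  (pTime_pieces .comma hs).map (f := fun _ l => List.length l) snd.length

theorem pTime_writeBits {d : α → List Bool} (hd : PTime d) : PTime fun x => writeBits (d x) :=
  (hd.map (f := fun _ b => if b then Γ'.bit true else Γ'.bit false)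
    (snd.cond (.const _) (.const _))).append (.const _)

theorem pTime_writeProfile {P : α → List (List ℕ)} (hP : PTime P) :
    PTime fun x => writeProfile (P x) := by
  have h : PTime fun V : List ℕ => V.flatMap fun a => List.replicate a (Γ'.bit true) ++ [.comma] :=
    PTime.flatMap (f := fun _ a => List.replicate a (Γ'.bit true) ++ [.comma]) id
      ((snd.replicate (.const _)).append (.const _))
  exact hP.flatMap (f := fun _ V =>
    (V.flatMap fun a => List.replicate a (Γ'.bit true) ++ [.comma]) ++ [.ket])
    ((h.comp snd).append (.const _))

theorem pTime_isInstance {d : α → List Bool} {P : α → List (List ℕ)} (hd : PTime d)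
    (hP : PTime P) : PTime fun x => isInstance (d x) (P x) :=
  (hd.any (f := fun _ b => b) snd).and (hP.all (f := fun x V => isVote (d x).length V)
    (pTime_isVote (hd.comp fst).length snd))

theorem pTime_betterDec : PTime (betterDec p q) := by
  have hs : PTime fun w : List Γ' => pieces .ket w := pTime_pieces .ket id
  have hd₁ : PTime fun w : List Γ' => readBits ((pieces .ket w).headD []) :=
    pTime_readBits (hs.headD (.const []))
  have hd₂ : PTime fun w : List Γ' => readBits ((pieces .ket w).tail.headD []) :=
    pTime_readBits (hs.tail.headD (.const []))
  have hP : PTime fun w : List Γ' => (pieces .ket w).tail.tail.map readVote :=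
    hs.tail.tail.map (f := fun _ s => readVote s) (pTime_readVote snd)
  exact (PTime.eq (((pTime_writeBits hd₁).append (pTime_writeBits hd₂)).append
    (pTime_writeProfile hP)) id).and ((pTime_isInstance hd₁ hP).and
    ((pTime_isInstance hd₂ hP).and ((hd₁.length.eq hd₂.length).and
    (((pTime_listCard hd₁).mul (pTime_listScoreSum p q hd₂ hP)).le
      ((pTime_listCard hd₂).mul (pTime_listScoreSum p q hd₁ hP))))))

theorem pTime_optimalDec : PTime (optimalDec p q) := by
  have hs : PTime fun w : List Γ' => pieces .ket w := pTime_pieces .ket id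
  have hd : PTime fun w : List Γ' => readBits ((pieces .ket w).headD []) :=
    pTime_readBits (hs.headD (.const []))
  have hP : PTime fun w : List Γ' => (pieces .ket w).tail.map readVote :=
    hs.tail.map (f := fun _ s => readVote s) (pTime_readVote snd)
  have hd' := hd.comp (fst (β := ℕ))
  have hd'' := hd'.comp (fst (β := ℕ))
  have hP'' := (hP.comp (fst (β := ℕ))).comp (fst (β := ℕ))
  exact (PTime.eq ((pTime_writeBits hd).append (pTime_writeProfile hP)) id).and
    ((pTime_isInstance hd hP).and (.all hd.length.range ((hd'.getD snd (.const false)).not.or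
      (.all hd'.length.range ((pTime_listScore p q hd''.length hP'' snd).le
        (pTime_listScore p q hd''.length hP'' (snd.comp fst)))))))

end PTime

/-! ### Correctness of the decision procedures -/

section Correctness

variable {m : ℕ}

/-- A vote as a list of numbers. -/
def voteList (V : Vote m) : List ℕ := (List.ofFn V).map Fin.val

/-- The membership bits of a decision. -/
def decisionBits (d : Decision m) : List Bool := List.ofFn fun a : Fin m => decide (a ∈ d.1)

theorem length_voteList (V : Vote m) : (voteList V).length = m := by simp [voteList]

theorem length_decisionBits (d : Decision m) : (decisionBits d).length = m := by
  simp [decisionBits]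

theorem getD_decisionBits (d : Decision m) (a : Fin m) :
    (decisionBits d).getD a false = decide (a ∈ d.1) := by
  rw [List.getD_eq_getElem _ _ (by rw [length_decisionBits]; exact a.2)]
  simp [decisionBits]

theorem nodup_voteList (V : Vote m) : (voteList V).Nodup :=
  (List.nodup_ofFn.2 V.injective).map Fin.val_injective

theorem mem_voteList (V : Vote m) (a : Fin m) : (a : ℕ) ∈ voteList V :=
  List.mem_map_of_mem ((List.mem_ofFn' V a).2 ⟨V.symm a, V.apply_symm_apply a⟩)

theorem idxOf_voteList (V : Vote m) (a : Fin m) : (voteList V).idxOf (a : ℕ) = V.symm a := by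
  have hlt : (V.symm a : ℕ) < (voteList V).length := by
    rw [length_voteList]; exact (V.symm a).2
  have h : (voteList V)[(V.symm a : ℕ)] = a := by simp [voteList]
  conv_lhs => rw [← h]
  exact (nodup_voteList V).idxOf_getElem _ hlt

theorem before_eq {a : ℕ} (b : ℕ) {V : List ℕ} (ha : a ∈ V) :
    before a b V = decide (V.idxOf a ≤ V.idxOf b) := by
  induction V with
  | nil => simp at ha
  | cons x V ih =>
    have hcons : before a b (x :: V) =
      if decide (x = a) then true else if decide (x = b) then false else before a b V := rfl
    rw [hcons]
    by_cases hxa : x = a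
    · subst hxa
      simp
    · have ha' : a ∈ V := (List.mem_cons.1 ha).resolve_left (Ne.symm hxa)
      by_cases hxb : x = b
      · subst hxb
        simp [hxa, List.idxOf_cons_ne]
      · simp [hxa, hxb, List.idxOf_cons_ne, ih ha']

theorem before_voteList (V : Vote m) (a b : Fin m) :
    before a b (voteList V) = decide (V.symm a ≤ V.symm b) := by
  rw [before_eq _ (mem_voteList V a), idxOf_voteList, idxOf_voteList]
  rfl

theorem listBeatWeight_eq (p q : ℕ) (P : Profile m) (a b : Fin m) :
    listBeatWeight p q (P.map voteList) a b = beatWeight p q P a b := by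
  unfold listBeatWeight beatWeight
  rw [List.map_map]
  congr 1
  refine List.map_congr_left fun V _ => ?_
  simp [before_voteList]

theorem prod_map_range (f : ℕ → ℕ) (m : ℕ) :
    ((List.range m).map f).prod = ∏ a : Fin m, f a := by
  rw [Fin.prod_univ_eq_prod_range]
  rfl

theorem sum_map_range (f : ℕ → ℕ) (m : ℕ) :
    ((List.range m).map f).sum = ∑ a : Fin m, f a := by
  rw [Fin.sum_univ_eq_sum_range]
  rfl

theorem listScore_eq (p q : ℕ) (P : Profile m) (c : Fin m) :
    listScore p q m (P.map voteList) c = score p q P c := by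
  simp only [listScore, score, prod_map_range, listBeatWeight_eq, decide_eq_true_eq,
    Fin.val_inj]

theorem listScoreSum_eq (p q : ℕ) (P : Profile m) (d : Decision m) :
    listScoreSum p q (decisionBits d) (P.map voteList) = ∑ c ∈ d.1, score p q P c := by
  simp only [listScoreSum, length_decisionBits, sum_map_range, getD_decisionBits, listScore_eq,
    decide_eq_true_eq, Finset.sum_ite_mem, Finset.univ_inter]

theorem listCard_eq (d : Decision m) : listCard (decisionBits d) = d.1.card := by
  simp only [listCard, length_decisionBits, sum_map_range, getD_decisionBits,
    decide_eq_true_eq, Finset.sum_ite_mem, Finset.univ_inter, Finset.sum_const, smul_eq_mul,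
    mul_one]

theorem isVote_iff {V : List ℕ} : isVote m V = true ↔ ∃ σ : Vote m, V = voteList σ := by
  have hiff : isVote m V = true ↔ V.length = m ∧ ∀ a < m, a ∈ V := by
    simp [isVote]
  rw [hiff]
  constructor
  · rintro ⟨hlen, hmem⟩
    have hperm : (List.range m).Perm V := by
      refine (List.subperm_of_subset List.nodup_range fun a ha =>
        hmem a (List.mem_range.1 ha)).perm_of_length_le ?_
      rw [List.length_range, hlen]
    have hnodup : V.Nodup := hperm.nodup_iff.1 List.nodup_range
    have hlt : ∀ a ∈ V, a < m := fun a ha => List.mem_range.1 (hperm.mem_iff.2 ha)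
    let f : Fin m → Fin m := fun i => ⟨V[i.1]'(hlen ▸ i.2), hlt _ (List.getElem_mem _)⟩
    have hf : Function.Injective f := fun i j h => by
      simp only [f, Fin.mk.injEq] at h
      exact Fin.ext ((hnodup.getElem_inj_iff).1 h)
    refine ⟨Equiv.ofBijective f (Finite.injective_iff_bijective.1 hf), ?_⟩
    refine List.ext_getElem (by rw [hlen, length_voteList]) fun i h₁ h₂ => ?_
    simp [voteList, f]
  · rintro ⟨σ, rfl⟩
    exact ⟨length_voteList σ, fun a ha => mem_voteList σ ⟨a, ha⟩⟩

theorem all_isVote_iff {P : List (List ℕ)} :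
    P.all (fun V => isVote m V) = true ↔ ∃ Q : Profile m, P = Q.map voteList := by
  rw [List.all_eq_true]
  constructor
  · intro h
    induction P with
    | nil => exact ⟨[], rfl⟩
    | cons V P ih =>
      obtain ⟨Q, hQ⟩ := ih fun W hW => h W (by simp [hW])
      obtain ⟨σ, hσ⟩ := isVote_iff.1 (h V (by simp))
      exact ⟨σ :: Q, by rw [List.map_cons, ← hσ, ← hQ]⟩
  · rintro ⟨Q, rfl⟩ V hV
    obtain ⟨σ, -, rfl⟩ := List.mem_map.1 hV
    exact isVote_iff.2 ⟨σ, rfl⟩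

theorem any_bits_iff {d : List Bool} (hd : d.length = m) :
    d.any (fun b => b) = true ↔ ∃ D : Decision m, d = decisionBits D := by
  subst hd
  constructor
  · intro h
    obtain ⟨b, hb, h⟩ := List.any_eq_true.1 h
    obtain ⟨i, hi, rfl⟩ := List.getElem_of_mem hb
    refine ⟨⟨Finset.univ.filter fun a : Fin d.length => d[a] = true, ⟨⟨i, hi⟩, by simpa using h⟩⟩,
      List.ext_getElem (length_decisionBits _).symm fun j h₁ h₂ => ?_⟩
    simp [decisionBits]
  · rintro ⟨⟨D, a, ha⟩, e⟩
    refine List.any_eq_true.2 ⟨true, ?_, rfl⟩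
    rw [e, decisionBits, List.mem_ofFn']
    exact ⟨a, by simpa using ha⟩

theorem isInstance_iff {d : List Bool} {P : List (List ℕ)} (hd : d.length = m) :
    isInstance d P = true ↔
      (∃ D : Decision m, d = decisionBits D) ∧ ∃ Q : Profile m, P = Q.map voteList := by
  rw [isInstance, Bool.and_eq_true, any_bits_iff hd, hd, all_isVote_iff]

theorem writeBits_decisionBits (d : Decision m) : writeBits (decisionBits d) = encodeDecision d := by
  unfold writeBits decisionBits encodeDecision
  rw [List.map_ofFn]
  congr 2
  funext a
  simp only [Function.comp_apply]
  cases decide (a ∈ d.1) <;> rfl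

theorem writeProfile_map_voteList (P : Profile m) :
    writeProfile (P.map voteList) = encodeProfile P := by
  unfold writeProfile encodeProfile
  rw [List.flatMap_map]
  congr 1
  funext V
  unfold encodeVote voteList
  rw [List.flatMap_map]
  rfl

theorem pieces_append (k : Γ') (s r : List Γ') (hs : k ∉ s) :
    pieces k (s ++ k :: r) = s :: pieces k r := by
  induction s with
  | nil =>
    have h : pieces k (k :: r) = if decide (k = k) then [] :: pieces k r else _ := rfl
    rw [List.nil_append, h]
    simp
  | cons x s ih =>
    have hx : ¬ x = k := fun e => hs (by simp [e])
    have h : pieces k (x :: (s ++ k :: r)) = if decide (x = k) then _ else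
      match pieces k (s ++ k :: r) with
      | [] => [[x]]
      | s :: t => (x :: s) :: t := rfl
    rw [List.cons_append, h, ih fun e => hs (by simp [e])]
    simp [hx]

theorem pieces_encodeDecision (d : Decision m) (r : List Γ') :
    pieces .ket (encodeDecision d ++ r) =
      (decisionBits d).map Γ'.bit :: pieces .ket r := by
  have h : encodeDecision d ++ r = (decisionBits d).map Γ'.bit ++ .ket :: r := by
    rw [encodeDecision, decisionBits, List.map_ofFn, List.append_assoc]
    rfl
  rw [h]
  exact pieces_append _ _ _ (by simp)

theorem readBits_map_bit (l : List Bool) : readBits (l.map Γ'.bit) = l := by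
  rw [readBits, List.map_map]
  refine (List.map_congr_left fun b _ => ?_).trans (List.map_id l)
  cases b <;> decide

theorem readVote_flatMap (l : List (Fin m)) :
    readVote (l.flatMap encodeAlternative) = l.map Fin.val := by
  unfold readVote
  induction l with
  | nil => rfl
  | cons a l ih =>
    have h : (a :: l).flatMap encodeAlternative =
        List.replicate (a : ℕ) (Γ'.bit true) ++ (.comma :: l.flatMap encodeAlternative) := by
      rw [List.flatMap_cons, encodeAlternative, List.append_assoc]
      rfl
    rw [h, pieces_append _ _ _ (by simp [List.mem_replicate]), List.map_cons, ih,
      List.length_replicate]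
    rfl

theorem map_readVote_pieces_encodeProfile (P : Profile m) :
    (pieces .ket (encodeProfile P)).map readVote = P.map voteList := by
  induction P with
  | nil => rfl
  | cons V P ih =>
    have h : encodeProfile (V :: P) =
        (List.ofFn V).flatMap encodeAlternative ++ .ket :: encodeProfile P := by
      rw [encodeProfile, List.flatMap_cons, encodeVote, List.append_assoc]
      rfl
    rw [h, pieces_append, List.map_cons, ih, readVote_flatMap]
    · rfl
    · simp [encodeAlternative, List.mem_replicate]

theorem betterDec_iff {φ : ℚ} {p q : ℕ} (hp : p ≠ 0) (hq : q ≠ 0) (hφ : (φ : ℝ) = p / q)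
    (w : List Γ') : betterDec p q w = true ↔ w ∈ BetterBayesianDecision (φ : ℝ) := by
  rw [hφ]
  constructor
  · intro h
    unfold betterDec betterCheck at h
    simp only [Bool.and_eq_true, decide_eq_true_eq] at h
    generalize readBits ((pieces .ket w).headD []) = d₁ at h
    generalize readBits ((pieces .ket w).tail.headD []) = d₂ at h
    generalize (pieces .ket w).tail.tail.map readVote = P at h
    obtain ⟨hw, h₁, h₂, hlen, hle⟩ := h
    obtain ⟨m, hm⟩ : ∃ m, d₁.length = m := ⟨_, rfl⟩
    obtain ⟨⟨D₁, rfl⟩, Q, rfl⟩ := (isInstance_iff hm).1 h₁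
    obtain ⟨⟨D₂, rfl⟩, -⟩ := (isInstance_iff (hlen.symm.trans hm)).1 h₂
    rw [writeBits_decisionBits, writeBits_decisionBits, writeProfile_map_voteList] at hw
    rw [listCard_eq, listCard_eq, listScoreSum_eq, listScoreSum_eq] at hle
    exact ⟨m, D₁, D₂, Q, hw.symm, (condorcetRisk_le_iff hp hq Q D₁ D₂).2 hle⟩
  · rintro ⟨m, D₁, D₂, Q, rfl, h⟩
    rw [condorcetRisk_le_iff hp hq] at h
    have e₁ := pieces_encodeDecision D₁ (encodeDecision D₂ ++ encodeProfile Q)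
    rw [← List.append_assoc] at e₁
    have e₂ := pieces_encodeDecision D₂ (encodeProfile Q)
    unfold betterDec
    rw [e₁, e₂, List.tail_cons, List.headD_cons, List.headD_cons, List.tail_cons,
      readBits_map_bit, readBits_map_bit, map_readVote_pieces_encodeProfile]
    unfold betterCheck
    rw [writeBits_decisionBits, writeBits_decisionBits, writeProfile_map_voteList,
      (isInstance_iff (length_decisionBits D₁)).2 ⟨⟨D₁, rfl⟩, Q, rfl⟩,
      (isInstance_iff (length_decisionBits D₂)).2 ⟨⟨D₂, rfl⟩, Q, rfl⟩,
      length_decisionBits, length_decisionBits, listCard_eq, listCard_eq, listScoreSum_eq,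
      listScoreSum_eq]
    simpa using h

theorem optimalDec_iff {φ : ℚ} {p q : ℕ} (hp : p ≠ 0) (hq : q ≠ 0) (hφ : (φ : ℝ) = p / q)
    (w : List Γ') : optimalDec p q w = true ↔ w ∈ OptimalBayesianDecision (φ : ℝ) := by
  rw [hφ]
  have key : ∀ {m : ℕ} (D : Decision m) (Q : Profile m),
      ((List.range m).all fun c => !(decisionBits D).getD c false || (List.range m).all fun b =>
        decide (listScore p q m (Q.map voteList) b ≤ listScore p q m (Q.map voteList) c)) = true ↔
      ∀ d', condorcetRisk (p / q : ℝ) Q D ≤ condorcetRisk (p / q : ℝ) Q d' := by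
    intro m D Q
    rw [condorcetRisk_optimal_iff hp hq]
    simp only [List.all_eq_true, List.mem_range, Bool.or_eq_true, Bool.not_eq_true',
      decide_eq_true_eq]
    constructor
    · intro h c hc b
      have := (h c c.2).resolve_left (by rw [getD_decisionBits]; simpa using hc) b b.2
      rwa [listScore_eq, listScore_eq] at this
    · intro h c hc
      by_cases hD : (⟨c, hc⟩ : Fin m) ∈ D.1
      · refine .inr fun b hb => ?_
        have := h _ hD ⟨b, hb⟩
        rwa [← listScore_eq, ← listScore_eq] at this
      · exact .inl ((getD_decisionBits D ⟨c, hc⟩).trans (decide_eq_false hD))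
  constructor
  · intro h
    unfold optimalDec optimalCheck at h
    rw [Bool.and_eq_true, Bool.and_eq_true, decide_eq_true_eq] at h
    generalize readBits ((pieces .ket w).headD []) = d at h
    generalize (pieces .ket w).tail.map readVote = P at h
    obtain ⟨hw, h₁, h₂⟩ := h
    obtain ⟨m, hm⟩ : ∃ m, d.length = m := ⟨_, rfl⟩
    obtain ⟨⟨D, rfl⟩, Q, rfl⟩ := (isInstance_iff hm).1 h₁
    rw [writeBits_decisionBits, writeProfile_map_voteList] at hw
    rw [length_decisionBits, key] at h₂
    exact ⟨m, D, Q, hw.symm, h₂⟩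
  · rintro ⟨m, D, Q, rfl, h⟩
    unfold optimalDec
    rw [pieces_encodeDecision D (encodeProfile Q), List.headD_cons, List.tail_cons,
      readBits_map_bit, map_readVote_pieces_encodeProfile]
    unfold optimalCheck
    rw [writeBits_decisionBits, writeProfile_map_voteList,
      (isInstance_iff (length_decisionBits D)).2 ⟨⟨D, rfl⟩, Q, rfl⟩, length_decisionBits,
      (key D Q).2 h]
    simp

end Correctness

end BayesVoting

theorem theorem4 (φ : ℚ) (hφ_pos : 0 < φ) (hφ_lt_one : φ < 1) :
    BayesVoting.InP (BayesVoting.BetterBayesianDecision (φ : ℝ)) ∧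
      BayesVoting.InP (BayesVoting.OptimalBayesianDecision (φ : ℝ)) := by
  have hp : φ.num.toNat ≠ 0 := by
    have := Rat.num_pos.2 hφ_pos
    omega
  have hφ : (φ : ℝ) = (φ.num.toNat : ℕ) / (φ.den : ℕ) := by
    have h : ((φ.num.toNat : ℕ) : ℤ) = φ.num := Int.toNat_of_nonneg (Rat.num_pos.2 hφ_pos).le
    rw [← Int.cast_natCast (R := ℝ) φ.num.toNat, h]
    exact Rat.cast_def φ
  exact ⟨BayesVoting.inP_of_pTime _ _ (BayesVoting.pTime_betterDec _ _)
      (BayesVoting.betterDec_iff hp φ.den_nz hφ),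
    BayesVoting.inP_of_pTime _ _ (BayesVoting.pTime_optimalDec _ _)
      (BayesVoting.optimalDec_iff hp φ.den_nz hφ)⟩
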